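/- **Definitions.** A finite set $\mathcal X\subset\mathbb R^2$ of $\binom{n+2}{2}$ nodes is *$n$-correct* if Lagrange interpolation at $\mathcal X$ by bivariate polynomials of total degree $\le n$ is uniquely solvable; it is a *$GC_n$ set* if moreover the fundamental polynomial of each node is a product of $n$ linear factors. A node *uses* a line if the line is a factor of its fundamental polynomial; $\mathcal X^\ell$ is the set of nodes that use $\ell$. A line is *maximal* if it contains $n+1$ nodes; $M(\mathcal X)$ is the set of maximal lines and $\mathrm{def}(\mathcal X)=n+2-\#M(\mathcal X)$. A *$k_m$-node* is a node lying in exactly $k$ maximal lines. For a line $\ell$, a maximal line $\lambda$ is *$\ell$-disjoint* if $\lambda\cap\ell\cap\mathcal X=\emptyset$, and two maximal lines $\lambda'\ne\lambda''$, both different from $\ell$, are *$\ell$-adjoint* if $\lambda'\cap\lambda''\cap\ell$ is a node. The *$\ell$-lowering* $\hat{\mathcal X}=\hat{\mathcal X}(\ell)$ is obtained from $\mathcal X$ by removing all $\ell$-disjoint maximal lines and all pairs of $\ell$-adjoint maximal lines. A line $\ell$ with $2\le\#(\ell\cap\mathcal X)\le n$ is *proper* ($\ell\in Pr(\mathcal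 X)$) if it is maximal in $\hat{\mathcal X}$, and *proper $(-r)$* if it becomes maximal after $r$ further steps, starting with $\hat{\mathcal X}$, each of which removes an $\ell$-disjoint maximal line or a pair of $\ell$-adjoint maximal lines of the current set; the line, or the union of the pair, removed at step $k$ is the *$(-k)$ d/a item*. If $\ell$ is neither maximal nor proper, a *$\hat 2_m$-node* of $\ell$ is a point of $\ell$ that is a $2_m$-node of $\hat{\mathcal X}$. Let $\mathcal X$ be a $GC_n$ set of defect $2$. It has a single $0_m$-node $O$; the lines joining $O$ with $1_m$-nodes are called $O$-lines. Let $\lambda_i\ne\lambda_j$ be maximal lines; each contains two $1_m$-nodes. Let $n_{ij}$ be the number of $O$-lines that contain at least one of these four nodes. **Proposition 4.3.** Let $\mathcal X$ be a $GC_n$ set of defect $2$ and $\lambda_i\neq\lambda_j$ two of its maximal lines with $n_{ij}=3$. Then exactly one $O$-line, $\ell^o:=\ell^o_{k(i,j)}$, contains two of the four $1_m$-nodes lying on $\lambda_i$ and $\lambda_j$, one on each line, and the other two determine a line $\ell:=\ell_{ij}$. Let $\hat{\mathcal X}$ be the $\ell$-lowering of $\mathcal X$. The lines $\ell^o$ and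 $\ell$ have at most one common point, $S$ say, and no other point is a $\hat 2_m$-node of $\ell$ (if $\ell^o\parallel\ell$ then $S$ does not exist and $\ell$ has no $\hat 2_m$-node). We have $\ell^o\in Pr(\mathcal X)\cap M(\hat{\mathcal X})$, and, if $S$ exists, the following are equivalent: 1. $S\in\hat{\mathcal X}$; 2. $S$ is a $1_m$-node of $\mathcal X$; 3. $S$ is a $\hat 2_m$-node of $\ell$; 4. $S=\ell^o\cap\lambda^*$ for some $\lambda^*\in M(\mathcal X)\cap M(\hat{\mathcal X})$. Next, $\mathrm{def}(\hat{\mathcal X})=1$, $\#\mathcal X^\ell=1$, and $\ell$ is proper $(-1)$, with $\mathcal X^\ell=\hat{\mathcal X}\setminus(\mathcal C\cup\ell)$, where $\mathcal C$ is the $(-1)$ d/a item. Moreover, if $S$ does not exist or $S\notin\hat{\mathcal X}$, then $\hat{\mathcal X}$ is a $GC_2$ set and $\mathcal C=\ell^o$. If $S\in\hat{\mathcal X}$, then $\hat{\mathcal X}$ is a $GC_3$ set and $\mathcal C=\ell^o\cup\lambda^*$ for some $\lambda^*\in M(\mathcal X)$ with $S\in\lambda^*$. -/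

import Mathlib

namespace GCPlane

/-- Points of the real plane, `P 0` and `P 1` being the two coordinates. -/
abbrev Pt := Fin 2 → ℝ

/-- Real polynomials in two variables. -/
abbrev Poly := MvPolynomial (Fin 2) ℝ

/-- The zero set of a bivariate polynomial. -/
def zeroSet (p : Poly) : Set Pt := {P | MvPolynomial.eval P p = 0}

/-- A line is the zero set of a polynomial of total degree exactly `1`. -/
def IsLine (l : Set Pt) : Prop := ∃ L : Poly, L.totalDegree = 1 ∧ l = zeroSet L

/-- `X` is `n`-correct: it has `(n+2 choose 2)` nodes, and Lagrange interpolation at `X` by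
polynomials of total degree at most `n` is uniquely solvable. -/
def IsCorrect (n : ℕ) (X : Set Pt) : Prop :=
  X.Finite ∧ X.ncard = (n + 2).choose 2 ∧
    ∀ c : Pt → ℝ, ∃! p : Poly, p.totalDegree ≤ n ∧ ∀ A ∈ X, MvPolynomial.eval A p = c A

/-- `p` is an `n`-fundamental polynomial of the node `A` of `X`. -/
def IsFundamental (n : ℕ) (X : Set Pt) (A : Pt) (p : Poly) : Prop :=
  p.totalDegree ≤ n ∧ MvPolynomial.eval A p = 1 ∧
    ∀ B ∈ X, B ≠ A → MvPolynomial.eval B p = 0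

/-- `X` is a `GC_n` set: it is `n`-correct, and the fundamental polynomial of each node is a product
of `n` linear factors. -/
def IsGC (n : ℕ) (X : Set Pt) : Prop :=
  IsCorrect n X ∧ ∀ A ∈ X, ∃ L : Fin n → Poly,
    (∀ i, (L i).totalDegree = 1) ∧ IsFundamental n X A (∏ i, L i)

/-- The set `M(X)` of maximal lines of the `n`-correct set `X`: the lines through exactly `n + 1`
nodes. -/
def maxLines (n : ℕ) (X : Set Pt) : Set (Set Pt) :=
  {l | IsLine l ∧ (l ∩ X).ncard = n + 1}

/-- The defect `n + 2 - #M(X)` of an `n`-correct set. -/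
noncomputable def defect (n : ℕ) (X : Set Pt) : ℤ := (n : ℤ) + 2 - ((maxLines n X).ncard : ℤ)

/-- `A` is a `k_m`-node of `X`: a node lying in exactly `k` maximal lines. -/
def IsKmNode (n : ℕ) (X : Set Pt) (k : ℕ) (A : Pt) : Prop :=
  A ∈ X ∧ {l ∈ maxLines n X | A ∈ l}.encard = k

/-- The set `X^l` of the nodes of `X` that use the line `l`, that is, whose fundamental polynomial
has the equation of `l` as a factor. -/
def usingNodes (n : ℕ) (X l : Set Pt) : Set Pt :=
  {A ∈ X | ∃ p L q : Poly, IsFundamental n X A p ∧ L.totalDegree = 1 ∧ l = zeroSet L ∧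
    q.totalDegree ≤ n - 1 ∧ p = L * q}

/-- The maximal line `c` of `X` is `l`-disjoint: it does not meet `l` at a node. -/
def IsDisjointLine (n : ℕ) (X l c : Set Pt) : Prop :=
  c ∈ maxLines n X ∧ c ∩ l ∩ X = ∅

/-- The maximal lines `c`, `d` of `X` are `l`-adjoint: `c`, `d`, `l` are three different lines
that are concurrent at a node. -/
def IsAdjointPair (n : ℕ) (X l c d : Set Pt) : Prop :=
  c ∈ maxLines n X ∧ d ∈ maxLines n X ∧ c ≠ d ∧ c ≠ l ∧ d ≠ l ∧ (c ∩ d ∩ l ∩ X).Nonempty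

/-- The `l`-lowering of `X`: remove all `l`-disjoint maximal lines and all pairs of `l`-adjoint
maximal lines of `X`. -/
def lowering (n : ℕ) (X l : Set Pt) : Set Pt :=
  X \ (⋃₀ {c | IsDisjointLine n X l c} ∪ ⋃₀ {c | ∃ d, IsAdjointPair n X l c d})

/-- `l` is a proper line of `X`: a `k`-node line, `2 ≤ k ≤ n`, that is a maximal line of the
`l`-lowering of `X`. The degree `m` of the lowering is determined by its number of nodes. -/
def IsProper (n : ℕ) (X l : Set Pt) : Prop :=
  2 ≤ (l ∩ X).ncard ∧ (l ∩ X).ncard ≤ n ∧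
    ∃ m, IsCorrect m (lowering n X l) ∧ l ∈ maxLines m (lowering n X l)

/-- `DAChain l m Y Cs`: starting with the set `Y` of degree `m`, the line `l` becomes a maximal
line after the successive disjoint or adjoint reductions whose items are listed in `Cs`. An item
is an `l`-disjoint maximal line (the degree drops by `1`) or the union of two `l`-adjoint maximal
lines (the degree drops by `2`) of the set reached so far. -/
inductive DAChain (l : Set Pt) : ℕ → Set Pt → List (Set Pt) → Prop
  | nil {m : ℕ} {Y : Set Pt} (h : l ∈ maxLines m Y) : DAChain l m Y []
  | disjoint {m : ℕ} {Y c : Set Pt} {Cs : List (Set Pt)} (h : l ∉ maxLines (m + 1) Y)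
      (hc : IsDisjointLine (m + 1) Y l c) (hr : DAChain l m (Y \ c) Cs) :
      DAChain l (m + 1) Y (c :: Cs)
  | adjoint {m : ℕ} {Y c d : Set Pt} {Cs : List (Set Pt)} (h : l ∉ maxLines (m + 2) Y)
      (hc : IsAdjointPair (m + 2) Y l c d) (hr : DAChain l m (Y \ (c ∪ d)) Cs) :
      DAChain l (m + 2) Y ((c ∪ d) :: Cs)

/-- The `k`-node line `l`, `2 ≤ k ≤ n`, becomes maximal after disjoint or adjoint reductions starting
with the `l`-lowering of `X`, and `Cs` lists the `(-1), (-2), …` disjoint/adjoint items. -/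
def HasDAItems (n : ℕ) (X l : Set Pt) (Cs : List (Set Pt)) : Prop :=
  2 ≤ (l ∩ X).ncard ∧ (l ∩ X).ncard ≤ n ∧
    ∃ m, IsCorrect m (lowering n X l) ∧ DAChain l m (lowering n X l) Cs

/-- `l` is proper `(-r)`: it becomes maximal after `r` reductions, starting with the
`l`-lowering. -/
def IsProperMinus (r n : ℕ) (X l : Set Pt) : Prop :=
  ∃ Cs : List (Set Pt), Cs.length = r ∧ HasDAItems n X l Cs

/-- `A` is a hat-`2_m`-node of the line `l`, which is neither maximal nor proper: a point of `l`
that is a `2_m`-node of the `l`-lowering of `X`. -/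
def IsHatTwoNode (n : ℕ) (X l : Set Pt) (A : Pt) : Prop :=
  l ∉ maxLines n X ∧ ¬ IsProper n X l ∧ A ∈ l ∧
    ∃ m, IsCorrect m (lowering n X l) ∧ IsKmNode m (lowering n X l) 2 A

/-- `o` is an `O`-line of the defect `2` set `X`: a line joining a `0_m`-node (in a `GC_n` set of
defect `2` there is a single one, `O`) and a `1_m`-node. These are the three lines
through `O` that cover all `1_m`-nodes. -/
def IsOLine (n : ℕ) (X o : Set Pt) : Prop :=
  IsLine o ∧ (∃ O ∈ o, IsKmNode n X 0 O) ∧ ∃ P ∈ o, IsKmNode n X 1 P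

/-- The number `n_ij` of `O`-lines that contain at least one of the `1_m`-nodes of the two maximal
lines `li`, `lj`. -/
noncomputable def oLineCount (n : ℕ) (X li lj : Set Pt) : ℕ :=
  {o | IsOLine n X o ∧ ∃ P ∈ o, IsKmNode n X 1 P ∧ (P ∈ li ∨ P ∈ lj)}.ncard

/-- The lines attached to a pair `li`, `lj` of maximal lines with `n_ij = 3`: the four `1_m`-nodes
on `li` and `lj` are `a, a' ∈ li` and `b, b' ∈ lj`, the two nodes `a`, `b` belong to the same
`O`-line `o`, and `l = l_ij` is the line through the other two, `a'` and `b'`. -/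
def IsLinePair (n : ℕ) (X li lj o l : Set Pt) : Prop :=
  ∃ a a' b b' : Pt, a ≠ a' ∧ b ≠ b' ∧
    {P ∈ li | IsKmNode n X 1 P} = {a, a'} ∧ {P ∈ lj | IsKmNode n X 1 P} = {b, b'} ∧
    IsOLine n X o ∧ a ∈ o ∧ b ∈ o ∧ IsLine l ∧ a' ∈ l ∧ b' ∈ l

end GCPlane

open GCPlane

/-! ### Bivariate polynomials of degree one and divisibility by the equation of a line. -/

namespace GCPlane
open MvPolynomial

/-! Removing a maximal line from a `GC` set lowers the degree by one, keeps the other maximal lines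
maximal, and does not change which other lines the remaining nodes use. A set of defect 2 has `n`
maximal lines, so keeping only those in `K` leaves a `GC` set of degree `#K`
(`IsDefectTwo.keep_spec`). For `K = ∅` only the node `O` is left. For two lines meeting at `A`, six
nodes are left: `A`, `O` and four `1_m`-nodes. The two lines covering all but `A` split the
`1_m`-nodes of each maximal line, and one passes through `O` (`IsDefectTwo.exists_conic`). When
`n_ij = 3` the other misses `O`; these two lines are `o` and `l`.

The `l`-lowering keeps exactly the maximal lines meeting `l` at a `1_m`-node
(`IsDefectTwo.lowering_eq`). The main point is `PairConfig.one_on_l`: besides `a'` and `b'`, a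
`1_m`-node on `l` can only be the point `S` of `o ∩ l`. So the kept lines are `li`, `lj` and
possibly one line `λ*` through `S`, giving degree 2 or 3. The line `o` meets each of them at a
`1_m`-node and contains `O`, so it is maximal in the lowering, and it is the only new maximal line
(`PairConfig.maxLines_lowering`); hence the defect is 1. Removing `o`, or `o` and `λ*`, leaves
degree 1 with `a'`, `b'` on `l`, so `l` becomes maximal. Inspection of the `0_m`-, `1_m`- and
`2_m`-nodes shows that `A` alone uses `l`. -/

lemma totalDegree_le_one_form (p : Poly) (h : p.totalDegree ≤ 1) :
    ∃ a b c : ℝ, p = C a * X 0 + C b * X 1 + C c := by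
  refine ⟨p.coeff (Finsupp.single 0 1), p.coeff (Finsupp.single 1 1), p.coeff 0, ?_⟩
  ext m
  have hm : m = Finsupp.single 0 (m 0) + Finsupp.single 1 (m 1) := by
    ext i; fin_cases i <;> simp
  by_cases h0 : m 0 + m 1 ≤ 1
  · rw [hm]
    generalize m 0 = s at *
    generalize m 1 = t at *
    have : (s = 0 ∧ t = 0) ∨ (s = 1 ∧ t = 0) ∨ (s = 0 ∧ t = 1) := by omega
    have h10 : (Finsupp.single (1 : Fin 2) 1 : Fin 2 →₀ ℕ) ≠ Finsupp.single 0 1 := by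
      simp [Finsupp.single_eq_single_iff]
    have h01 : (Finsupp.single (0 : Fin 2) 1 : Fin 2 →₀ ℕ) ≠ Finsupp.single 1 1 := by
      simp [Finsupp.single_eq_single_iff]
    rcases this with ⟨rfl, rfl⟩ | ⟨rfl, rfl⟩ | ⟨rfl, rfl⟩ <;>
      simp [coeff_C_mul, coeff_X, coeff_C, h10, h01, eq_comm]
  · have hz : p.coeff m = 0 := by
      apply coeff_eq_zero_of_totalDegree_lt
      have : ∑ i ∈ m.support, m i = m 0 + m 1 := by
        rw [← Fin.sum_univ_two]
        exact Finset.sum_subset (Finset.subset_univ _) (by simp)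
      rw [this]; omega
    have e0 : Finsupp.single (0 : Fin 2) 1 ≠ m := by rintro rfl; simp at h0
    have e1 : Finsupp.single (1 : Fin 2) 1 ≠ m := by rintro rfl; simp at h0
    have e2 : (0 : Fin 2 →₀ ℕ) ≠ m := by rintro rfl; simp at h0
    simp [hz, coeff_C_mul, coeff_X, coeff_C, e0, e1, e2]

/-- A polynomial of degree one, solved for one of the two variables. -/
lemma totalDegree_eq_one_form (p : Poly) (h : p.totalDegree = 1) :
    ∃ (i j : Fin 2) (a b c : ℝ), i ≠ j ∧ (∀ k, k = i ∨ k = j) ∧ a ≠ 0 ∧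
      p = C a * X i + C b * X j + C c := by
  obtain ⟨a, b, c, hp⟩ := totalDegree_le_one_form p h.le
  by_cases ha : a = 0
  · by_cases hb : b = 0
    · subst ha hb
      rw [hp] at h
      simp at h
    · refine ⟨1, 0, b, a, c, by decide, by decide, hb, ?_⟩
      rw [hp]; ring
  · exact ⟨0, 1, a, b, c, by decide, by decide, ha, hp⟩

lemma totalDegree_linear (a b c : ℝ) (h : a ≠ 0 ∨ b ≠ 0) :
    (C a * X 0 + C b * X 1 + C c : Poly).totalDegree = 1 := by
  apply le_antisymm
  · refine (totalDegree_add _ _).trans (max_le ((totalDegree_add _ _).trans (max_le ?_ ?_)) (by simp))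
    · exact (totalDegree_mul _ _).trans (by simp)
    · exact (totalDegree_mul _ _).trans (by simp)
  · have h10 : (Finsupp.single (1 : Fin 2) 1 : Fin 2 →₀ ℕ) ≠ Finsupp.single 0 1 := by
      simp [Finsupp.single_eq_single_iff]
    have h01 : (Finsupp.single (0 : Fin 2) 1 : Fin 2 →₀ ℕ) ≠ Finsupp.single 1 1 := by
      simp [Finsupp.single_eq_single_iff]
    rcases h with h | h
    · have : (Finsupp.single 0 1) ∈ (C a * X 0 + C b * X 1 + C c : Poly).support := by
        simpa [coeff_C_mul, coeff_X, coeff_C, h10, eq_comm] using h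
      simpa using le_totalDegree this
    · have : (Finsupp.single 1 1) ∈ (C a * X 0 + C b * X 1 + C c : Poly).support := by
        simpa [coeff_C_mul, coeff_X, coeff_C, h01, eq_comm] using h
      simpa using le_totalDegree this

lemma natDegree_aeval_le {f : Fin 2 → Polynomial ℝ} (hf : ∀ i, (f i).natDegree ≤ 1) (p : Poly) :
    (aeval f p).natDegree ≤ p.totalDegree := by
  rw [aeval_def, eval₂_eq]
  refine Polynomial.natDegree_sum_le_of_forall_le _ _ fun d hd => ?_
  refine Polynomial.natDegree_mul_le.trans ?_
  simp only [Polynomial.algebraMap_eq, Polynomial.natDegree_C, zero_add]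
  refine (Polynomial.natDegree_prod_le _ _).trans ((Finset.sum_le_sum fun i _ => ?_).trans
    (le_totalDegree hd))
  exact Polynomial.natDegree_pow_le.trans (by nlinarith [hf i])

/-- A polynomial of degree at most `k` with more than `k` zeros on a line is divisible by the
equation of the line. -/
lemma line_dvd {L p : Poly} {k : ℕ} (hL : L.totalDegree = 1) (hp : p.totalDegree ≤ k)
    (s : Finset Pt) (hs : ∀ P ∈ s, P ∈ zeroSet L ∧ eval P p = 0) (hk : k < s.card) :
    ∃ q : Poly, q.totalDegree ≤ k - 1 ∧ p = L * q := by
  obtain ⟨i, j, a, b, c, hij, hall, ha, rfl⟩ := totalDegree_eq_one_form L hL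
  set L : Poly := C a * X i + C b * X j + C c with hLdef
  -- The line, parametrized by its `j`-th coordinate.
  let f : Fin 2 → Polynomial ℝ := fun t =>
    if t = i then Polynomial.C (-c / a) + Polynomial.C (-b / a) * Polynomial.X else Polynomial.X
  have hfi : f i = Polynomial.C (-c / a) + Polynomial.C (-b / a) * Polynomial.X := if_pos rfl
  have hfj : f j = Polynomial.X := if_neg hij.symm
  have hline : ∀ P ∈ zeroSet L, P i = -c / a + -b / a * P j := by
    intro P hP
    have : a * P i + b * P j + c = 0 := by simpa [zeroSet, hLdef] using hP
    field_simp; linarith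
  have hfz : aeval f p = 0 := by
    have hinj : Set.InjOn (fun P : Pt => P j) s := by
      intro P hP Q hQ h
      ext t
      rcases hall t with rfl | rfl
      · rw [hline P (hs P hP).1, hline Q (hs Q hQ).1]; simp only at h; rw [h]
      · exact h
    refine Polynomial.eq_zero_of_natDegree_lt_card_of_eval_eq_zero' _ (s.image fun P => P j) ?_ ?_
    · intro t ht
      obtain ⟨P, hP, rfl⟩ := Finset.mem_image.1 ht
      have : (Polynomial.aeval (P j)) (aeval f p) = aeval P p := by
        rw [← AlgHom.comp_apply, comp_aeval]
        congr 2
        ext t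
        rcases hall t with rfl | rfl
        · simp [hfi, hline P (hs P hP).1]
        · simp [hfj]
      rw [← Polynomial.coe_aeval_eq_eval, this, MvPolynomial.aeval_eq_eval]
      exact (hs P hP).2
    · rw [Finset.card_image_of_injOn hinj]
      refine lt_of_le_of_lt ((natDegree_aeval_le ?_ p).trans hp) hk
      intro t
      rcases hall t with rfl | rfl
      · rw [hfi]; compute_degree
      · rw [hfj]; exact Polynomial.natDegree_X_le
  have hdvd : L ∣ p := by
    rw [← Ideal.mem_span_singleton, ← Ideal.Quotient.eq_zero_iff_mem]
    let mk := Ideal.Quotient.mkₐ ℝ (Ideal.span {L})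
    -- Modulo `L` the variable `X i` equals its expression in `X j`, so reduction modulo `L` factors
    -- through restriction to the line, where `p` vanishes.
    have : mk = (mk.comp (Polynomial.aeval (X j : Poly))).comp (aeval f) := by
      apply MvPolynomial.algHom_ext
      intro t
      rcases hall t with rfl | rfl
      · have : (X t : Poly) - (C (-c / a) + C (-b / a) * X j) = C a⁻¹ * L := by
          simp only [hLdef, mul_add, ← mul_assoc, ← C_mul, inv_mul_cancel₀ ha, neg_div, C_neg]
          simp only [C_1, div_eq_inv_mul]
          ring
        simp only [AlgHom.comp_apply, aeval_X, hfi, map_add, map_mul, Polynomial.aeval_C,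
          Polynomial.aeval_X]
        rw [← map_mul, ← map_add, ← sub_eq_zero, ← map_sub]
        have h2 := congrArg mk this
        have hmL : mk L = 0 := Ideal.Quotient.eq_zero_iff_mem.2 (Ideal.mem_span_singleton_self L)
        rw [map_mul, hmL, mul_zero] at h2
        exact h2
      · simp [hfj]
    have h3 := congrArg (fun g => g p) this
    simp only [AlgHom.comp_apply, hfz, map_zero] at h3
    exact h3
  obtain ⟨q, rfl⟩ := hdvd
  refine ⟨q, ?_, rfl⟩
  by_cases hq : q = 0
  · simp [hq]
  · have hL0 : L ≠ 0 := by intro h; rw [h] at hL; simp at hL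
    rw [totalDegree_mul_of_isDomain hL0 hq, hL] at hp
    omega

/-! ### Lines as point sets. -/

lemma mem_zeroSet {p : Poly} {P : Pt} : P ∈ zeroSet p ↔ eval P p = 0 := Iff.rfl

lemma IsLine.exists_eq {l : Set Pt} (h : IsLine l) :
    ∃ a b c : ℝ, (a ≠ 0 ∨ b ≠ 0) ∧ ∀ P : Pt, P ∈ l ↔ a * P 0 + b * P 1 + c = 0 := by
  obtain ⟨L, hL, rfl⟩ := h
  obtain ⟨a, b, c, hp⟩ := totalDegree_le_one_form L hL.le
  refine ⟨a, b, c, ?_, fun P => by simp [mem_zeroSet, hp]⟩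
  by_contra! h
  rw [hp, h.1, h.2] at hL
  simp at hL

lemma IsLine.ext {g h : Set Pt} (hg : IsLine g) (hh : IsLine h) {P Q : Pt} (hPQ : P ≠ Q)
    (hPg : P ∈ g) (hQg : Q ∈ g) (hPh : P ∈ h) (hQh : Q ∈ h) : g = h := by
  obtain ⟨a, b, c, hab, hG⟩ := hg.exists_eq
  obtain ⟨a', b', c', hab', hH⟩ := hh.exists_eq
  rw [hG] at hPg hQg
  rw [hH] at hPh hQh
  have hne : P 0 - Q 0 ≠ 0 ∨ P 1 - Q 1 ≠ 0 := by
    by_contra! h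
    apply hPQ
    ext i
    fin_cases i
    · exact sub_eq_zero.1 h.1
    · exact sub_eq_zero.1 h.2
  have key : ∀ a b c a' b' c' : ℝ, (a ≠ 0 ∨ b ≠ 0) → 
      a * P 0 + b * P 1 + c = 0 → a * Q 0 + b * Q 1 + c = 0 →
      a' * P 0 + b' * P 1 + c' = 0 → a' * Q 0 + b' * Q 1 + c' = 0 → 
      ∀ R : Pt, a * R 0 + b * R 1 + c = 0 → a' * R 0 + b' * R 1 + c' = 0 := by
    intro a b c a' b' c' hab h1 h2 h3 h4 R h5
    have e1 : a * (P 0 - Q 0) + b * (P 1 - Q 1) = 0 := by linarith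
    have e2 : a' * (P 0 - Q 0) + b' * (P 1 - Q 1) = 0 := by linarith
    -- Both normals annihilate the nonzero vector `P - Q`, so they are proportional.
    have e3 : a * b' - a' * b = 0 := by
      rcases hne with h | h
      · apply (mul_eq_zero.1 (show (P 0 - Q 0) * (a * b' - a' * b) = 0 from ?_)).resolve_left h
        linear_combination b' * e1 - b * e2
      · apply (mul_eq_zero.1 (show (P 1 - Q 1) * (a * b' - a' * b) = 0 from ?_)).resolve_left h
        linear_combination a * e2 - a' * e1
    have e4 : a * (R 0 - P 0) + b * (R 1 - P 1) = 0 := by linarith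
    have e5 : a' * (R 0 - P 0) + b' * (R 1 - P 1) = 0 := by
      rcases hab with h | h
      · apply (mul_eq_zero.1 (show a * _ = 0 from ?_)).resolve_left h
        linear_combination a' * e4 + (R 1 - P 1) * e3
      · apply (mul_eq_zero.1 (show b * _ = 0 from ?_)).resolve_left h
        linear_combination b' * e4 - (R 0 - P 0) * e3
    linarith
  ext R
  rw [hG, hH]
  exact ⟨key a b c a' b' c' hab hPg hQg hPh hQh R, key a' b' c' a b c hab' hPh hQh hPg hQg R⟩

lemma exists_line (P Q : Pt) (hPQ : P ≠ Q) : ∃ l, IsLine l ∧ P ∈ l ∧ Q ∈ l := by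
  have hne : P 1 - Q 1 ≠ 0 ∨ Q 0 - P 0 ≠ 0 := by
    by_contra! h
    apply hPQ
    ext i
    fin_cases i
    · exact (sub_eq_zero.1 h.2).symm
    · exact sub_eq_zero.1 h.1
  refine ⟨_, ⟨_, totalDegree_linear (P 1 - Q 1) (Q 0 - P 0) (P 0 * Q 1 - P 1 * Q 0) hne, rfl⟩,
    ?_, ?_⟩
  · simp [mem_zeroSet]; ring
  · simp [mem_zeroSet]; ring

lemma IsLine.infinite {l : Set Pt} (h : IsLine l) : l.Infinite := by
  obtain ⟨L, hL, rfl⟩ := h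
  obtain ⟨i, j, a, b, c, hij, hall, ha, rfl⟩ := totalDegree_eq_one_form L hL
  let f : ℝ → Pt := fun t k => if k = i then -(b * t + c) / a else t
  refine Set.infinite_of_injective_forall_mem (f := f) ?_ ?_
  · intro s t h
    simpa [f, hij.symm] using congrFun h j
  · intro t
    simp only [mem_zeroSet, f, map_add, map_mul, eval_C, eval_X, if_true, if_neg hij.symm]
    field_simp
    ring

end GCPlane

/-! ### Covers by lines and removal of maximal lines from `GC` sets. -/

namespace GCPlane
open MvPolynomial

/-- `n` lines that avoid the node `A` and cover all other nodes of `X`. -/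
def IsCover (n : ℕ) (X : Set Pt) (A : Pt) (ls : Fin n → Set Pt) : Prop :=
  (∀ i, IsLine (ls i)) ∧ (∀ i, A ∉ ls i) ∧ ∀ B ∈ X, B ≠ A → ∃ i, B ∈ ls i

lemma IsGC.exists_cover {n : ℕ} {X : Set Pt} (hX : IsGC n X) {A : Pt} (hA : A ∈ X) :
    ∃ ls, IsCover n X A ls := by
  obtain ⟨L, hL, -, h1, h0⟩ := hX.2 A hA
  refine ⟨fun i => zeroSet (L i), fun i => ⟨_, hL i, rfl⟩, fun i hi => ?_, fun B hB hBA => ?_⟩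
  · rw [map_prod, Finset.prod_eq_zero (Finset.mem_univ i) (mem_zeroSet.1 hi)] at h1
    exact zero_ne_one h1
  · have := h0 B hB hBA
    rw [map_prod, Finset.prod_eq_zero_iff] at this
    obtain ⟨i, -, hi⟩ := this
    exact ⟨i, hi⟩

/-- Scaling each line equation to the value 1 at `A` turns a cover into a factored fundamental
polynomial, so covers can replace polynomials below. -/
lemma IsCover.exists_poly {n : ℕ} {X : Set Pt} {A : Pt} {ls : Fin n → Set Pt}
    (h : IsCover n X A ls) : ∃ L : Fin n → Poly, (∀ i, (L i).totalDegree = 1) ∧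
      (∀ i, ls i = zeroSet (L i)) ∧ IsFundamental n X A (∏ i, L i) := by
  obtain ⟨h1, h2, h3⟩ := h
  choose L hL hl using h1
  have hA : ∀ i, eval A (L i) ≠ 0 := fun i hi => h2 i (by rw [hl i]; exact hi)
  have hz : ∀ i P, eval P (C (eval A (L i))⁻¹ * L i) = 0 ↔ P ∈ ls i := by
    intro i P
    rw [hl i, mem_zeroSet]
    simp [hA i]
  have hdeg : ∀ i, (C (eval A (L i))⁻¹ * L i).totalDegree = 1 := by
    intro i
    have hL0 : L i ≠ 0 := by intro h; have := hA i; simp [h] at this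
    rw [totalDegree_mul_of_isDomain (by simpa using hA i) hL0, hL i, totalDegree_C]
  refine ⟨fun i => C (eval A (L i))⁻¹ * L i, hdeg, fun i => ?_, ?_, ?_, ?_⟩
  · ext P; exact (hz i P).symm
  · refine (totalDegree_finsetProd _ _).trans ?_
    simp [hdeg]
  · rw [map_prod]
    refine Finset.prod_eq_one fun i _ => ?_
    simp [hA i]
  · intro B hB hBA
    obtain ⟨i, hi⟩ := h3 B hB hBA
    rw [map_prod]
    exact Finset.prod_eq_zero (Finset.mem_univ i) ((hz i B).2 hi)

lemma IsGC.of_cover {n : ℕ} {X : Set Pt} (hX : IsCorrect n X)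
    (h : ∀ A ∈ X, ∃ ls, IsCover n X A ls) : IsGC n X := by
  refine ⟨hX, fun A hA => ?_⟩
  obtain ⟨ls, hls⟩ := h A hA
  obtain ⟨L, hL, -, hf⟩ := hls.exists_poly
  exact ⟨L, hL, hf⟩

/-- Pigeonhole: two of the more than `n` points lie on the same line of the cover, which is then
`l`. -/
lemma IsCover.exists_eq {n : ℕ} {X : Set Pt} {A : Pt} {ls : Fin n → Set Pt}
    (h : IsCover n X A ls) {l : Set Pt} (hl : IsLine l) {s : Set Pt} (hsl : s ⊆ l) (hsX : s ⊆ X)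
    (hA : A ∉ s) (hs : n < s.ncard) : ∃ i, ls i = l := by
  obtain ⟨h1, h2, h3⟩ := h
  -- `Option` supplies a default value off `s` even when `Fin n` is empty.
  have hex : ∀ P : Pt, ∃ i : Option (Fin n), P ∈ s → ∃ j, i = some j ∧ P ∈ ls j := by
    intro P
    by_cases hP : P ∈ s
    · obtain ⟨i, hi⟩ := h3 P (hsX hP) (fun e => hA (e ▸ hP))
      exact ⟨some i, fun _ => ⟨i, rfl, hi⟩⟩
    · exact ⟨none, fun h => absurd h hP⟩
  choose f hf using hex
  have hcard : (Set.range (some : Fin n → Option (Fin n))).ncard < s.ncard := by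
    rw [← Set.image_univ, Set.ncard_image_of_injective _ (Option.some_injective _)]
    simpa using hs
  obtain ⟨P, hP, Q, hQ, hPQ, he⟩ := Set.exists_ne_map_eq_of_ncard_lt_of_maps_to hcard
    (f := f) (fun P hP => by obtain ⟨j, hj, -⟩ := hf P hP; exact ⟨j, hj.symm⟩)
  obtain ⟨i, hi, hPi⟩ := hf P hP
  obtain ⟨j, hj, hQj⟩ := hf Q hQ
  have : i = j := by rw [hi, hj] at he; exact Option.some_injective _ he
  subst this
  exact ⟨i, (h1 i).ext hl hPQ hPi hQj (hsl hP) (hsl hQ)⟩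

lemma IsGC.finite {n : ℕ} {X : Set Pt} (hX : IsGC n X) : X.Finite := hX.1.1

lemma IsGC.ncard_inter_le {n : ℕ} {X : Set Pt} (hX : IsGC n X) {l : Set Pt} (hl : IsLine l) :
    (l ∩ X).ncard ≤ n + 1 := by
  by_contra! hlt
  have hfin : (l ∩ X).Finite := hX.finite.subset Set.inter_subset_right
  obtain ⟨A, hA⟩ := (Set.ncard_pos hfin).1 (by omega)
  obtain ⟨ls, hls⟩ := hX.exists_cover hA.2
  obtain ⟨i, hi⟩ := hls.exists_eq hl (s := (l ∩ X) \ {A}) (fun P hP => hP.1.1) (fun P hP => hP.1.2)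
    (by simp) (by rw [Set.ncard_sdiff_singleton_of_mem hA]; omega)
  exact hls.2.1 i (hi ▸ hA.1)

lemma IsCorrect.eq_zero {n : ℕ} {X : Set Pt} (hX : IsCorrect n X) {p : Poly}
    (hp : p.totalDegree ≤ n) (h : ∀ A ∈ X, eval A p = 0) : p = 0 :=
  (hX.2.2 fun _ => 0).unique ⟨hp, h⟩ ⟨by simp, by simp⟩

/-- Interpolate the data `L * c` on `X`: the solution vanishes at the `n + 2` nodes of the line, so
it is `L * q`, and `q` interpolates `c` off the line. Uniqueness is inherited after multiplication
by `L`. -/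
lemma IsCorrect.diff_maxLine {n : ℕ} {X l : Set Pt} (hX : IsCorrect (n + 1) X)
    (hl : l ∈ maxLines (n + 1) X) : IsCorrect n (X \ l) := by
  obtain ⟨⟨L, hL, rfl⟩, hcard⟩ := hl
  have hL0 : L ≠ 0 := by intro h; rw [h] at hL; simp at hL
  have hfin : (zeroSet L ∩ X).Finite := hX.1.subset Set.inter_subset_right
  refine ⟨hX.1.subset Set.sdiff_subset, ?_, fun c => ?_⟩
  · have h1 := Set.ncard_inter_add_ncard_sdiff_eq_ncard X (zeroSet L) hX.1
    rw [Set.inter_comm, hcard, hX.2.1] at h1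
    have h2 : (n + 1 + 2).choose 2 = (n + 2) + (n + 2).choose 2 := by
      rw [show n + 1 + 2 = (n + 2) + 1 from rfl, Nat.choose_succ_succ' (n + 2) 1, Nat.choose_one_right]
    omega
  · classical
    obtain ⟨p, ⟨hp, hpe⟩, -⟩ := hX.2.2 fun A => eval A L * c A
    obtain ⟨q, hq, rfl⟩ := line_dvd hL hp hfin.toFinset
      (fun P hP => by
        rw [Set.Finite.mem_toFinset] at hP
        refine ⟨hP.1, ?_⟩
        rw [hpe P hP.2, mem_zeroSet.1 hP.1, zero_mul])
      (by rw [← Set.ncard_eq_toFinset_card _ hfin, hcard]; omega)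
    refine ⟨q, ⟨by omega, fun A hA => ?_⟩, fun r hr => ?_⟩
    · have := hpe A hA.1
      rw [map_mul] at this
      exact mul_left_cancel₀ hA.2 this
    · have hd : L * (r - q) = 0 := by
        refine hX.eq_zero ?_ fun A hA => ?_
        · refine (totalDegree_mul _ _).trans ?_
          have := totalDegree_sub r q
          have := hr.1
          rw [hL]
          have : (r - q).totalDegree ≤ n := by omega
          omega
        · rw [map_mul, map_sub, mul_sub, sub_eq_zero]
          by_cases hAl : A ∈ zeroSet L
          · rw [mem_zeroSet.1 hAl]; simp
          · rw [hr.2 A ⟨hA, hAl⟩, ← hpe A hA, map_mul]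
      exact sub_eq_zero.1 ((mul_eq_zero.1 hd).resolve_left hL0)

/-- The lines of a cover other than a maximal line cover the nodes outside this line. -/
lemma IsCover.diff_maxLine {n : ℕ} {X l : Set Pt} {A : Pt} {ls : Fin (n + 1) → Set Pt}
    (h : IsCover (n + 1) X A ls) (hl : l ∈ maxLines (n + 1) X) (hA : A ∉ l) :
    ∃ i, ls i = l ∧ IsCover n (X \ l) A fun j => ls (i.succAbove j) := by
  obtain ⟨i, hi⟩ := h.exists_eq hl.1 (s := l ∩ X) Set.inter_subset_left Set.inter_subset_right
    (fun h => hA h.1) (by rw [hl.2]; omega)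
  refine ⟨i, hi, fun j => h.1 _, fun j => h.2.1 _, fun B hB hBA => ?_⟩
  obtain ⟨k, hk⟩ := h.2.2 B hB.1 hBA
  have hki : k ≠ i := by rintro rfl; exact hB.2 (hi ▸ hk)
  obtain ⟨j, rfl⟩ := Fin.exists_succAbove_eq hki
  exact ⟨j, hk⟩

lemma IsGC.diff_maxLine {n : ℕ} {X l : Set Pt} (hX : IsGC (n + 1) X)
    (hl : l ∈ maxLines (n + 1) X) : IsGC n (X \ l) := by
  refine IsGC.of_cover (hX.1.diff_maxLine hl) fun A hA => ?_
  obtain ⟨ls, hls⟩ := hX.exists_cover hA.1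
  obtain ⟨i, -, hi⟩ := hls.diff_maxLine hl hA.2
  exact ⟨_, hi⟩

/-- If `m` met `l` at no node, it would keep all its nodes in `X \ l`, one too many for the lower
degree. -/
lemma IsGC.exists_mem_inter {n : ℕ} {X l m : Set Pt} (hX : IsGC n X) (hl : l ∈ maxLines n X)
    (hm : m ∈ maxLines n X) : ∃ P ∈ X, P ∈ l ∧ P ∈ m := by
  cases n with
  | zero =>
    obtain ⟨P, hP⟩ := Set.ncard_eq_one.1 hl.2
    obtain ⟨Q, hQ⟩ := Set.ncard_eq_one.1 hm.2
    obtain ⟨O, hO⟩ := Set.ncard_eq_one.1 (show X.ncard = 1 from hX.1.2.1)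
    have hP' : P ∈ l ∩ X := by rw [hP]; rfl
    have hQ' : Q ∈ m ∩ X := by rw [hQ]; rfl
    have e1 : P = O := by have := hP'.2; rwa [hO] at this
    have e2 : Q = O := by have := hQ'.2; rwa [hO] at this
    exact ⟨P, hP'.2, hP'.1, by rw [e1, ← e2]; exact hQ'.1⟩
  | succ n =>
    by_contra! h
    have h1 := (hX.diff_maxLine hl).ncard_inter_le hm.1
    have : m ∩ (X \ l) = m ∩ X := by
      ext P
      exact ⟨fun h => ⟨h.1, h.2.1⟩, fun hP => ⟨hP.1, hP.2, fun hPl => h P hP.2 hPl hP.1⟩⟩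
    rw [this, hm.2] at h1
    omega

lemma IsGC.mem_maxLines_diff {n : ℕ} {X l m : Set Pt} (hX : IsGC (n + 1) X)
    (hl : l ∈ maxLines (n + 1) X) (hm : m ∈ maxLines (n + 1) X) (hlm : l ≠ m) :
    m ∈ maxLines n (X \ l) := by
  obtain ⟨P, hP, hPl, hPm⟩ := hX.exists_mem_inter hl hm
  refine ⟨hm.1, ?_⟩
  have : m ∩ (X \ l) = (m ∩ X) \ {P} := by
    ext Q
    constructor
    · rintro ⟨h1, h2, h3⟩
      exact ⟨⟨h1, h2⟩, fun e => h3 (by rw [Set.mem_singleton_iff.1 e]; exact hPl)⟩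
    · rintro ⟨⟨h1, h2⟩, h3⟩
      exact ⟨h1, h2, fun h => hlm (hl.1.ext hm.1 h3 h hPl h1 hPm)⟩
  have hmem : P ∈ m ∩ X := ⟨hPm, hP⟩
  rw [this, Set.ncard_sdiff_singleton_of_mem hmem, hm.2]
  rfl

/-- Once `k` is removed, `l` and `m` are still maximal and must meet at a node outside `k`. For `n =
0` this fails: every line through the only node is maximal. -/
lemma IsGC.not_concurrent {n : ℕ} {X k l m : Set Pt} (hn : 0 < n) (hX : IsGC n X)
    (hk : k ∈ maxLines n X) (hl : l ∈ maxLines n X) (hm : m ∈ maxLines n X) (hkl : k ≠ l)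
    (hkm : k ≠ m) (hlm : l ≠ m) {P : Pt} (hPk : P ∈ k) (hPl : P ∈ l) (hPm : P ∈ m) : False := by
  obtain ⟨n, rfl⟩ : ∃ k, n = k + 1 := ⟨n - 1, by omega⟩
  obtain ⟨Q, hQ, hQl, hQm⟩ := (hX.diff_maxLine hk).exists_mem_inter
    (hX.mem_maxLines_diff hk hl hkl) (hX.mem_maxLines_diff hk hm hkm)
  exact hlm (hl.1.ext hm.1 (P := P) (Q := Q) (fun e => hQ.2 (e ▸ hPk)) hPl hQl hPm hQm)

/-- The fundamental polynomial is unique, so a used line lies in the union of the finitely many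
cover lines; being infinite, it shares two points with one of them. -/
lemma IsCover.mem_usingNodes_iff {n : ℕ} {X l : Set Pt} {A : Pt} {ls : Fin n → Set Pt}
    (h : IsCover n X A ls) (hX : IsCorrect n X) (hA : A ∈ X) (hl : IsLine l) :
    A ∈ usingNodes n X l ↔ ∃ i, ls i = l := by
  obtain ⟨L, hL, hls, hf⟩ := h.exists_poly
  constructor
  · rintro ⟨-, p, M, q, hp, hM, rfl, hq, hpq⟩
    have hpe : p = ∏ i, L i := by
      refine sub_eq_zero.1 (hX.eq_zero ((totalDegree_sub _ _).trans (max_le hp.1 hf.1)) ?_)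
      intro B hB
      rw [map_sub, sub_eq_zero]
      by_cases hBA : B = A
      · rw [hBA, hp.2.1, hf.2.1]
      · rw [hp.2.2 B hB hBA, hf.2.2 B hB hBA]
    have hcov : ∀ P : Pt, ∃ i : Option (Fin n), P ∈ zeroSet M → ∃ j, i = some j ∧ P ∈ ls j := by
      intro P
      by_cases hP : P ∈ zeroSet M
      · have : eval P (∏ i, L i) = 0 := by rw [← hpe, hpq, map_mul, mem_zeroSet.1 hP, zero_mul]
        rw [map_prod, Finset.prod_eq_zero_iff] at this
        obtain ⟨i, -, hi⟩ := this
        exact ⟨some i, fun _ => ⟨i, rfl, by rw [hls]; exact hi⟩⟩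
      · exact ⟨none, fun h => absurd h hP⟩
    choose f hf using hcov
    obtain ⟨P, hP, Q, hQ, hPQ, he⟩ := hl.infinite.exists_ne_map_eq_of_mapsTo (f := f)
      (t := Set.univ) (fun _ _ => trivial) Set.finite_univ
    obtain ⟨i, hi, hPi⟩ := hf P hP
    obtain ⟨j, hj, hQj⟩ := hf Q hQ
    have : i = j := by rw [hi, hj] at he; exact Option.some_injective _ he
    subst this
    exact ⟨i, (h.1 i).ext hl hPQ hPi hQj hP hQ⟩
  · rintro ⟨i, rfl⟩
    refine ⟨hA, _, L i, ∏ j ∈ Finset.univ.erase i, L j, hf, hL i, hls i, ?_, ?_⟩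
    · refine (totalDegree_finsetProd _ _).trans ?_
      simp [hL]
    · rw [Finset.mul_prod_erase _ _ (Finset.mem_univ i)]

lemma IsGC.mem_usingNodes_diff_iff {n : ℕ} {X l m : Set Pt} (hX : IsGC (n + 1) X)
    (hl : l ∈ maxLines (n + 1) X) (hm : IsLine m) (hlm : l ≠ m) {A : Pt} (hA : A ∈ X \ l) :
    A ∈ usingNodes (n + 1) X m ↔ A ∈ usingNodes n (X \ l) m := by
  obtain ⟨ls, hls⟩ := hX.exists_cover hA.1
  obtain ⟨i, hi, hc⟩ := hls.diff_maxLine hl hA.2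
  rw [hls.mem_usingNodes_iff hX.1 hA.1 hm, hc.mem_usingNodes_iff (hX.1.diff_maxLine hl) hA hm]
  constructor
  · rintro ⟨k, hk⟩
    have hki : k ≠ i := by rintro rfl; exact hlm (hi.symm.trans hk)
    obtain ⟨j, rfl⟩ := Fin.exists_succAbove_eq hki
    exact ⟨j, hk⟩
  · rintro ⟨j, hj⟩
    exact ⟨_, hj⟩

/-- Removing several maximal lines from a `GC` set. -/
theorem IsGC.diff_sUnion (R : Finset (Set Pt)) : ∀ {n m : ℕ} {X : Set Pt}, IsGC n X →
    n = m + R.card → ↑R ⊆ maxLines n X →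
    IsGC m (X \ ⋃₀ ↑R) ∧ (∀ k ∈ maxLines n X, k ∉ R → k ∈ maxLines m (X \ ⋃₀ ↑R)) ∧
    ∀ B ∈ X \ ⋃₀ ↑R, ∀ k, IsLine k → k ∉ R →
      (B ∈ usingNodes n X k ↔ B ∈ usingNodes m (X \ ⋃₀ ↑R) k) := by
  classical
  induction R using Finset.induction_on with
  | empty =>
    intro n m X hX hn _
    obtain rfl : n = m := by simpa using hn
    simpa using hX
  | insert l R hlR ih =>
    intro n m X hX hn hR
    rw [Finset.card_insert_of_notMem hlR] at hn
    obtain ⟨n', rfl⟩ : ∃ k, n = k + 1 := ⟨m + R.card, by omega⟩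
    have hl : l ∈ maxLines (n' + 1) X := hR (by simp)
    obtain ⟨h1, h2, h3⟩ := ih (hX.diff_maxLine hl) (m := m) (by omega) (fun k hk =>
      hX.mem_maxLines_diff hl (hR (by simp [Finset.mem_coe.1 hk]))
        (fun e => hlR (e ▸ Finset.mem_coe.1 hk)))
    have hset : X \ ⋃₀ ↑(insert l R) = (X \ l) \ ⋃₀ ↑R := by
      rw [Finset.coe_insert, Set.sUnion_insert, Set.sdiff_sdiff]
    rw [hset]
    refine ⟨h1, fun k hk hkR => ?_, fun B hB k hk hkR => ?_⟩
    · rw [Finset.mem_insert, not_or] at hkR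
      exact h2 k (hX.mem_maxLines_diff hl hk (Ne.symm hkR.1)) hkR.2
    · rw [Finset.mem_insert, not_or] at hkR
      rw [hX.mem_usingNodes_diff_iff hl hk (Ne.symm hkR.1) hB.1]
      exact h3 B hB k hk hkR.2

/-- The definitions of proper lines, d/a items and hat nodes leave the degree of the lowering
existential; the node count determines it. -/
lemma IsCorrect.degree_unique {n m : ℕ} {X : Set Pt} (hn : IsCorrect n X) (hm : IsCorrect m X) :
    n = m := by
  have h : (n + 2).choose 2 = (m + 2).choose 2 := hn.2.1.symm.trans hm.2.1
  have hs : StrictMono fun k : ℕ => (k + 2).choose 2 := strictMono_nat_of_lt_succ fun k => by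
    show (k + 2).choose 2 < (k + 1 + 2).choose 2
    rw [show k + 1 + 2 = (k + 2) + 1 from rfl, Nat.choose_succ_succ' (k + 2) 1, Nat.choose_one_right]
    show (k + 2).choose 2 < (k + 2) + (k + 2).choose 2
    omega
  exact hs.injective h

end GCPlane

/-! ### Sets of defect two: `k_m`-nodes and the subsets left by a choice of maximal lines. -/

namespace GCPlane

/-- A `GC_n` set of defect two with `n > 0`. -/
structure IsDefectTwo (n : ℕ) (X : Set Pt) : Prop where
  gc : IsGC n X
  pos : 0 < n
  ncard : (maxLines n X).ncard = n

/-- The nodes left after removing the maximal lines that do not belong to `K`. -/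
def keep (n : ℕ) (X : Set Pt) (K : Set (Set Pt)) : Set Pt := X \ ⋃₀ (maxLines n X \ K)

lemma mem_keep {n : ℕ} {X : Set Pt} {K : Set (Set Pt)} {P : Pt} :
    P ∈ keep n X K ↔ P ∈ X ∧ ∀ l ∈ maxLines n X, P ∈ l → l ∈ K := by
  constructor
  · rintro ⟨h1, h2⟩
    exact ⟨h1, fun l hl hP => by_contra fun hK => h2 ⟨l, ⟨hl, hK⟩, hP⟩⟩
  · rintro ⟨h1, h2⟩
    exact ⟨h1, fun ⟨l, ⟨hl, hK⟩, hP⟩ => hK (h2 l hl hP)⟩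

lemma isKmNode_zero_iff {n : ℕ} {X : Set Pt} {P : Pt} :
    IsKmNode n X 0 P ↔ P ∈ X ∧ ∀ l ∈ maxLines n X, P ∉ l := by
  simp [IsKmNode, Set.encard_eq_zero, Set.eq_empty_iff_forall_notMem]

lemma isKmNode_one_iff {n : ℕ} {X : Set Pt} {P : Pt} :
    IsKmNode n X 1 P ↔ P ∈ X ∧ ∃ l ∈ maxLines n X, P ∈ l ∧ ∀ m ∈ maxLines n X, P ∈ m → m = l := by
  unfold IsKmNode
  rw [Nat.cast_one, Set.encard_eq_one]
  refine and_congr_right fun _ => ⟨?_, ?_⟩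
  · rintro ⟨l, hl⟩
    have h : l ∈ {l ∈ maxLines n X | P ∈ l} := by rw [hl]; rfl
    refine ⟨l, h.1, h.2, fun m hm hP => ?_⟩
    have : m ∈ {l ∈ maxLines n X | P ∈ l} := ⟨hm, hP⟩
    rwa [hl] at this
  · rintro ⟨l, hl, hP, hu⟩
    refine ⟨l, ?_⟩
    ext m
    exact ⟨fun h => hu m h.1 h.2, by rintro rfl; exact ⟨hl, hP⟩⟩

lemma IsKmNode.eq_of_mem {n : ℕ} {X l m : Set Pt} {P : Pt} (h : IsKmNode n X 1 P)
    (hl : l ∈ maxLines n X) (hm : m ∈ maxLines n X) (hPl : P ∈ l) (hPm : P ∈ m) : l = m := by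
  obtain ⟨-, k, -, -, hu⟩ := isKmNode_one_iff.1 h
  rw [hu l hl hPl, hu m hm hPm]

namespace IsDefectTwo

variable {n : ℕ} {X : Set Pt}

lemma finite (h : IsDefectTwo n X) : (maxLines n X).Finite :=
  Set.finite_of_ncard_pos (by rw [h.ncard]; exact h.pos)

lemma of_defect (hX : IsGC n X) (hn : 0 < n) (hd : defect n X = 2) : IsDefectTwo n X :=
  ⟨hX, hn, by unfold defect at hd; omega⟩

lemma keep_spec (h : IsDefectTwo n X) {K : Set (Set Pt)} (hK : K ⊆ maxLines n X) :
    IsGC K.ncard (keep n X K) ∧ (∀ k ∈ K, k ∈ maxLines K.ncard (keep n X K)) ∧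
    ∀ B ∈ keep n X K, ∀ k, IsLine k → k ∉ maxLines n X →
      (B ∈ usingNodes n X k ↔ B ∈ usingNodes K.ncard (keep n X K) k) := by
  have hfin : (maxLines n X \ K).Finite := h.finite.subset Set.sdiff_subset
  have hcard : n = K.ncard + hfin.toFinset.card := by
    rw [← Set.ncard_eq_toFinset_card _ hfin]
    have := Set.ncard_sdiff_add_ncard_of_subset hK h.finite
    rw [h.ncard] at this
    omega
  have := h.gc.diff_sUnion hfin.toFinset hcard (by simp)
  simp only [Set.Finite.coe_toFinset, Set.Finite.mem_toFinset] at this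
  refine ⟨this.1, fun k hk => this.2.1 k (hK hk) fun h => h.2 hk, fun B hB k hk hkM => ?_⟩
  exact this.2.2 B hB k hk fun h => hkM h.1

lemma existsUnique_zero (h : IsDefectTwo n X) : ∃ O, ∀ P, IsKmNode n X 0 P ↔ P = O := by
  have h0 := (h.keep_spec (K := ∅) (Set.empty_subset _)).1
  rw [Set.ncard_empty] at h0
  obtain ⟨O, hO⟩ := Set.ncard_eq_one.1 (show (keep n X ∅).ncard = 1 from h0.1.2.1)
  refine ⟨O, fun P => ?_⟩
  rw [isKmNode_zero_iff, ← Set.mem_singleton_iff, ← hO, mem_keep]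
  simp

/-- The other `n - 1` maximal lines meet `l` at distinct nodes, since no three are concurrent; of
its `n + 1` nodes two remain. -/
lemma ncard_one (h : IsDefectTwo n X) {l : Set Pt} (hl : l ∈ maxLines n X) :
    {P ∈ l | IsKmNode n X 1 P}.ncard = 2 := by
  have hex : ∀ m, ∃ P, m ∈ maxLines n X → P ∈ X ∧ P ∈ l ∧ P ∈ m := by
    intro m
    by_cases hm : m ∈ maxLines n X
    · obtain ⟨P, hP⟩ := h.gc.exists_mem_inter hl hm
      exact ⟨P, fun _ => hP⟩
    · exact ⟨0, fun h => absurd h hm⟩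
  choose f hf using hex
  have hXf : (l ∩ X).Finite := h.gc.finite.subset Set.inter_subset_right
  have hT : {P ∈ l | IsKmNode n X 1 P} ⊆ l ∩ X := fun P hP => ⟨hP.1, hP.2.1⟩
  have hun : l ∩ X = {P ∈ l | IsKmNode n X 1 P} ∪ f '' (maxLines n X \ {l}) := by
    ext P
    constructor
    · rintro ⟨hPl, hPX⟩
      by_cases hP : ∀ m ∈ maxLines n X, P ∈ m → m = l
      · exact Or.inl ⟨hPl, isKmNode_one_iff.2 ⟨hPX, l, hl, hPl, hP⟩⟩
      · push Not at hP
        obtain ⟨m, hm, hPm, hml⟩ := hP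
        refine Or.inr ⟨m, ⟨hm, hml⟩, ?_⟩
        by_contra hne
        exact hml (hm.1.ext hl.1 hne (hf m hm).2.2 hPm (hf m hm).2.1 hPl)
    · rintro (hP | ⟨m, ⟨hm, -⟩, rfl⟩)
      · exact hT hP
      · exact ⟨(hf m hm).2.1, (hf m hm).1⟩
  have hdisj : Disjoint {P ∈ l | IsKmNode n X 1 P} (f '' (maxLines n X \ {l})) := by
    rw [Set.disjoint_left]
    rintro P ⟨hPl, hP⟩ ⟨m, ⟨hm, hml⟩, rfl⟩
    exact hml (hP.eq_of_mem hm hl (hf m hm).2.2 hPl)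
  have hinj : Set.InjOn f (maxLines n X \ {l}) := by
    rintro m ⟨hm, hml⟩ k ⟨hk, hkl⟩ he
    by_contra hne
    exact h.gc.not_concurrent h.pos hm hk hl hne hml hkl (hf m hm).2.2
      (by rw [he]; exact (hf k hk).2.2) (hf m hm).2.1
  have hc := Set.ncard_union_eq hdisj (hXf.subset hT)
    ((h.finite.subset Set.sdiff_subset).image f)
  rw [← hun, hl.2, hinj.ncard_image, Set.ncard_sdiff_singleton_of_mem hl,
    h.ncard] at hc
  have := h.pos
  omega

/-- The nodes of a maximal line that lie on no other maximal line, given one of them. -/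
lemma exists_other (h : IsDefectTwo n X) {l : Set Pt} (hl : l ∈ maxLines n X) {x : Pt}
    (hxl : x ∈ l) (hx : IsKmNode n X 1 x) :
    ∃ y, y ∈ l ∧ IsKmNode n X 1 y ∧ x ≠ y ∧ {P ∈ l | IsKmNode n X 1 P} = {x, y} := by
  obtain ⟨u, v, huv, he⟩ := Set.ncard_eq_two.1 (h.ncard_one hl)
  have hx' : x ∈ ({u, v} : Set Pt) := he ▸ ⟨hxl, hx⟩
  have hu : u ∈ {P ∈ l | IsKmNode n X 1 P} := by rw [he]; simp
  have hv : v ∈ {P ∈ l | IsKmNode n X 1 P} := by rw [he]; simp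
  rcases hx' with rfl | hx'
  · exact ⟨v, hv.1, hv.2, huv, he⟩
  · rw [Set.mem_singleton_iff] at hx'
    subst hx'
    exact ⟨u, hu.1, hu.2, huv.symm, by rw [he, Set.pair_comm]⟩

lemma one_mem_keep {K : Set (Set Pt)} (hK : K ⊆ maxLines n X) {l : Set Pt}
    (hl : l ∈ K) {x : Pt} (hxl : x ∈ l) (hx : IsKmNode n X 1 x) : x ∈ keep n X K :=
  mem_keep.2 ⟨hx.1, fun m hm hxm => by rw [hx.eq_of_mem hm (hK hl) hxm hxl]; exact hl⟩

lemma zero_mem_keep {K : Set (Set Pt)} {O : Pt} (hO : IsKmNode n X 0 O) : O ∈ keep n X K :=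
  mem_keep.2 ⟨hO.1, fun m hm h => absurd h ((isKmNode_zero_iff.1 hO).2 m hm)⟩

/-- The two lines, besides maximal ones, used by the intersection node of two maximal lines. -/
lemma exists_conic (h : IsDefectTwo n X) {l m : Set Pt} (hl : l ∈ maxLines n X)
    (hm : m ∈ maxLines n X) (hlm : l ≠ m) {O B : Pt} (hO : IsKmNode n X 0 O) (hB : B ∈ X)
    (hBl : B ∈ l) (hBm : B ∈ m) :
    ∃ g k x x' y y', IsLine g ∧ IsLine k ∧ O ∈ g ∧ x ≠ x' ∧ y ≠ y' ∧
      {P ∈ l | IsKmNode n X 1 P} = {x, x'} ∧ {P ∈ m | IsKmNode n X 1 P} = {y, y'} ∧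
      x ∈ g ∧ y ∈ g ∧ x' ∈ k ∧ y' ∈ k ∧
      ∀ j, IsLine j → j ∉ maxLines n X → (B ∈ usingNodes n X j ↔ j = g ∨ j = k) := by
  have hK : ({l, m} : Set (Set Pt)) ⊆ maxLines n X := by
    rintro _ (rfl | rfl)
    exacts [hl, hm]
  have hs := h.keep_spec hK
  rw [Set.ncard_pair hlm] at hs
  obtain ⟨hgc, -, huse⟩ := hs
  have hBK : B ∈ keep n X {l, m} := by
    refine mem_keep.2 ⟨hB, fun k hk hBk => ?_⟩
    by_contra hne
    simp only [Set.mem_insert_iff, Set.mem_singleton_iff, not_or] at hne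
    exact h.gc.not_concurrent h.pos hk hl hm hne.1 hne.2 hlm hBk hBl hBm
  -- Degree 2: two lines cover the kept nodes other than `B`; the one through `O` is named `g`.
  obtain ⟨ls, hls⟩ := hgc.exists_cover hBK
  have hOK : O ∈ keep n X {l, m} := zero_mem_keep hO
  have hOB : O ≠ B := by
    rintro rfl
    exact (isKmNode_zero_iff.1 hO).2 l hl hBl
  obtain ⟨g, k, hg, hk, hOg, hBg, hBk, hcov, hus⟩ : ∃ g k, IsLine g ∧ IsLine k ∧ O ∈ g ∧ B ∉ g ∧
      B ∉ k ∧ (∀ P ∈ keep n X {l, m}, P ≠ B → P ∈ g ∨ P ∈ k) ∧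
      ∀ j, IsLine j → j ∉ maxLines n X → (B ∈ usingNodes n X j ↔ j = g ∨ j = k) := by
    have hc : ∀ P ∈ keep n X {l, m}, P ≠ B → P ∈ ls 0 ∨ P ∈ ls 1 := fun P hP hPB => by
      obtain ⟨i, hi⟩ := hls.2.2 P hP hPB
      rcases (Fin.exists_fin_two (p := fun i => P ∈ ls i)).1 ⟨i, hi⟩ with h | h
      exacts [Or.inl h, Or.inr h]
    have hu : ∀ j, IsLine j → j ∉ maxLines n X →
        (B ∈ usingNodes n X j ↔ j = ls 0 ∨ j = ls 1) := fun j hj hjM => by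
      rw [huse B hBK j hj hjM, hls.mem_usingNodes_iff hgc.1 hBK hj, Fin.exists_fin_two]
      simp only [eq_comm]
    rcases hc O hOK hOB with hO0 | hO1
    · exact ⟨ls 0, ls 1, hls.1 0, hls.1 1, hO0, hls.2.1 0, hls.2.1 1, hc, hu⟩
    · exact ⟨ls 1, ls 0, hls.1 1, hls.1 0, hO1, hls.2.1 1, hls.2.1 0,
        fun P hP hPB => (hc P hP hPB).symm, fun j hj hjM => by rw [hu j hj hjM, or_comm]⟩
  -- A cover line with both `1_m`-nodes of `j` would be `j` itself and contain `B`, so each takes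
  -- one.
  have key : ∀ j ∈ ({l, m} : Set (Set Pt)), B ∈ j → ∃ x x', x ≠ x' ∧
      {P ∈ j | IsKmNode n X 1 P} = {x, x'} ∧ x ∈ g ∧ x' ∈ k := by
    intro j hj hBj
    have hjM := hK hj
    obtain ⟨u, v, huv, he⟩ := Set.ncard_eq_two.1 (h.ncard_one hjM)
    have hu : u ∈ {P ∈ j | IsKmNode n X 1 P} := by rw [he]; simp
    have hv : v ∈ {P ∈ j | IsKmNode n X 1 P} := by rw [he]; simp
    have hne : ∀ P ∈ {P ∈ j | IsKmNode n X 1 P}, P ≠ B := by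
      rintro P hP rfl
      exact hlm (hP.2.eq_of_mem hl hm hBl hBm)
    have hu1 := hcov u (one_mem_keep hK hj hu.1 hu.2) (hne u hu)
    have hv1 := hcov v (one_mem_keep hK hj hv.1 hv.2) (hne v hv)
    have hgj : ¬ (u ∈ g ∧ v ∈ g) := fun ⟨h1, h2⟩ =>
      hBg (by rw [hg.ext hjM.1 huv h1 h2 hu.1 hv.1]; exact hBj)
    have hkj : ¬ (u ∈ k ∧ v ∈ k) := fun ⟨h1, h2⟩ =>
      hBk (by rw [hk.ext hjM.1 huv h1 h2 hu.1 hv.1]; exact hBj)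
    by_cases hug : u ∈ g
    · exact ⟨u, v, huv, he, hug, by tauto⟩
    · exact ⟨v, u, huv.symm, by rw [he, Set.pair_comm], by tauto, by tauto⟩
  obtain ⟨x, x', hx, hxe, hxg, hxk⟩ := key l (by simp) hBl
  obtain ⟨y, y', hy, hye, hyg, hyk⟩ := key m (by simp) hBm
  exact ⟨g, k, x, x', y, y', hg, hk, hOg, hx, hy, hxe, hye, hxg, hyg, hxk, hyk, hus⟩

/-- A line through the `0_m`-node becomes maximal when only the maximal lines are kept that it meets
at `1_m`-nodes. -/
lemma mem_maxLines_keep (h : IsDefectTwo n X) {K : Set (Set Pt)} (hK : K ⊆ maxLines n X)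
    {g : Set Pt} (hg : IsLine g) {O : Pt} (hO : IsKmNode n X 0 O) (hOg : O ∈ g)
    (hKg : ∀ k ∈ K, ∃ P ∈ g, P ∈ k ∧ IsKmNode n X 1 P) : g ∈ maxLines K.ncard (keep n X K) := by
  refine ⟨hg, ?_⟩
  have hgc := (h.keep_spec hK).1
  apply le_antisymm (hgc.ncard_inter_le hg)
  have hex : ∀ k, ∃ P, k ∈ K → P ∈ g ∧ P ∈ k ∧ IsKmNode n X 1 P := by
    intro k
    by_cases hk : k ∈ K
    · obtain ⟨P, hP⟩ := hKg k hk
      exact ⟨P, fun _ => hP⟩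
    · exact ⟨0, fun h => absurd h hk⟩
  choose f hf using hex
  -- The chosen `1_m`-nodes are distinct, so together with `O` they give the required `#K + 1` nodes
  -- on `g`.
  have hinj : Set.InjOn f K := by
    intro k hk m hm he
    exact (hf k hk).2.2.eq_of_mem (hK hk) (hK hm) (hf k hk).2.1 (he ▸ (hf m hm).2.1)
  have hOf : O ∉ f '' K := by
    rintro ⟨k, hk, rfl⟩
    exact (isKmNode_zero_iff.1 hO).2 k (hK hk) (hf k hk).2.1
  have hfin : K.Finite := h.finite.subset hK
  rw [← hinj.ncard_image, ← Set.ncard_insert_of_notMem hOf (hfin.image f)]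
  refine Set.ncard_le_ncard ?_ (hgc.finite.subset Set.inter_subset_right)
  rintro P (rfl | ⟨k, hk, rfl⟩)
  · exact ⟨hOg, zero_mem_keep hO⟩
  · exact ⟨(hf k hk).1, one_mem_keep hK hk (hf k hk).2.1 (hf k hk).2.2⟩

/-- Otherwise `mem_maxLines_keep` with all maximal lines kept would make `g` maximal in `X`, but `O`
lies on no maximal line. -/
lemma exists_not_one (h : IsDefectTwo n X) {g : Set Pt} (hg : IsLine g) {O : Pt}
    (hO : IsKmNode n X 0 O) (hOg : O ∈ g) :
    ∃ k ∈ maxLines n X, ∀ P ∈ g, P ∈ k → ¬ IsKmNode n X 1 P := by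
  by_contra! hc
  have hm := h.mem_maxLines_keep subset_rfl hg hO hOg hc
  have hk : keep n X (maxLines n X) = X := by simp [keep]
  rw [hk, h.ncard] at hm
  exact (isKmNode_zero_iff.1 hO).2 g hm hOg

/-- The maximal lines that meet `l` at a `1_m`-node. -/
def _root_.GCPlane.oneLines (n : ℕ) (X l : Set Pt) : Set (Set Pt) :=
  {k ∈ maxLines n X | ∃ P ∈ l, P ∈ k ∧ IsKmNode n X 1 P}

lemma oneLines_subset {l : Set Pt} : oneLines n X l ⊆ maxLines n X := fun _ h => h.1

/-- A maximal line meets `l` in at most one point. If this is no node, the line is disjoint; if it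
is a node on a second maximal line, the two are adjoint; otherwise it is a `1_m`-node and the line
survives. -/
lemma lowering_eq {l : Set Pt} (hl : IsLine l) (hlM : l ∉ maxLines n X) :
    lowering n X l = keep n X (oneLines n X l) := by
  unfold lowering keep
  congr 1
  have hne : ∀ k ∈ maxLines n X, k ≠ l := fun k hk e => hlM (e ▸ hk)
  ext P
  constructor
  · rintro (⟨k, ⟨hk, hd⟩, hP⟩ | ⟨k, ⟨m, hk, hm, hkm, -, -, Q, ⟨⟨hQk, hQm⟩, hQl⟩, hQX⟩, hP⟩)
    · refine ⟨k, ⟨hk, ?_⟩, hP⟩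
      rintro ⟨-, Q, hQl, hQk, hQ⟩
      have : Q ∈ k ∩ l ∩ X := ⟨⟨hQk, hQl⟩, hQ.1⟩
      rw [hd] at this
      exact this
    · refine ⟨k, ⟨hk, ?_⟩, hP⟩
      rintro ⟨-, R, hRl, hRk, hR⟩
      have : R = Q := by
        by_contra hRQ
        exact hne k hk (hk.1.ext hl hRQ hRk hQk hRl hQl)
      subst this
      exact hkm (hR.eq_of_mem hk hm hQk hQm)
  · rintro ⟨k, ⟨hk, hko⟩, hP⟩
    by_cases hd : k ∩ l ∩ X = ∅
    · exact Or.inl ⟨k, ⟨hk, hd⟩, hP⟩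
    · obtain ⟨Q, ⟨hQk, hQl⟩, hQX⟩ := Set.nonempty_iff_ne_empty.2 hd
      have : ¬ IsKmNode n X 1 Q := fun h => hko ⟨hk, Q, hQl, hQk, h⟩
      rw [isKmNode_one_iff] at this
      push Not at this
      obtain ⟨m, hm, hQm, hmk⟩ := this hQX k hk hQk
      exact Or.inr ⟨k, ⟨m, hk, hm, hmk.symm, hne k hk, hne m hm, Q, ⟨⟨hQk, hQm⟩, hQl⟩, hQX⟩, hP⟩

end IsDefectTwo

end GCPlane

/-! ### The configuration of a pair of maximal lines and the `1_m`-nodes on `l`. -/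

namespace GCPlane

lemma IsOLine.mem_zero {n : ℕ} {X o : Set Pt} {O : Pt} (hu : ∀ P, IsKmNode n X 0 P ↔ P = O)
    (ho : IsOLine n X o) : O ∈ o := by
  obtain ⟨-, ⟨P, hP, hPO⟩, -⟩ := ho
  rwa [(hu P).1 hPO] at hP

lemma IsDefectTwo.exists_concurrent {n : ℕ} {X : Set Pt} (h : IsDefectTwo n X) {l m : Set Pt}
    (hl : l ∈ maxLines n X) (hm : m ∈ maxLines n X) (hlm : l ≠ m) {O : Pt}
    (hO : IsKmNode n X 0 O) :
    ∃ g x y, IsLine g ∧ O ∈ g ∧ x ∈ g ∧ y ∈ g ∧ x ∈ l ∧ IsKmNode n X 1 x ∧ y ∈ m ∧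
      IsKmNode n X 1 y := by
  obtain ⟨B, hB, hBl, hBm⟩ := h.gc.exists_mem_inter hl hm
  obtain ⟨g, k, x, x', y, y', hg, -, hOg, -, -, hx, hy, hxg, hyg, -⟩ :=
    h.exists_conic hl hm hlm hO hB hBl hBm
  have h1 : x ∈ {P ∈ l | IsKmNode n X 1 P} := by rw [hx]; simp
  have h2 : y ∈ {P ∈ m | IsKmNode n X 1 P} := by rw [hy]; simp
  exact ⟨g, x, y, hg, hOg, hxg, hyg, h1.1, h1.2, h2.1, h2.2⟩

/-- Two maximal lines `li`, `lj` of a defect two set, meeting at `A`, with their `1_m`-nodes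
`a, a' ∈ li` and `b, b' ∈ lj`, such that `a, b` are on a line `o` through the `0_m`-node `O`
while the line `l` through `a', b'` does not contain `O`. -/
structure PairConfig (n : ℕ) (X li lj o l : Set Pt) (O A a a' b b' : Pt) : Prop where
  two : IsDefectTwo n X
  hi : li ∈ maxLines n X
  hj : lj ∈ maxLines n X
  hij : li ≠ lj
  zero : ∀ P, IsKmNode n X 0 P ↔ P = O
  hA : A ∈ X
  hAi : A ∈ li
  hAj : A ∈ lj
  haa : a ≠ a'
  hbb : b ≠ b'
  ones_i : {P ∈ li | IsKmNode n X 1 P} = {a, a'}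
  ones_j : {P ∈ lj | IsKmNode n X 1 P} = {b, b'}
  ho : IsLine o
  hl : IsLine l
  hOo : O ∈ o
  hao : a ∈ o
  hbo : b ∈ o
  ha'l : a' ∈ l
  hb'l : b' ∈ l
  hOl : O ∉ l
  use : ∀ k, IsLine k → k ∉ maxLines n X → (A ∈ usingNodes n X k ↔ k = o ∨ k = l)

namespace PairConfig

variable {n : ℕ} {X li lj o l : Set Pt} {O A a a' b b' : Pt}

/-- Lets the one-sided lemmas about `li`, `a`, `a'` serve for `lj`, `b`, `b'`. -/
lemma symm (c : PairConfig n X li lj o l O A a a' b b') :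
    PairConfig n X lj li o l O A b b' a a' :=
  ⟨c.two, c.hj, c.hi, c.hij.symm, c.zero, c.hA, c.hAj, c.hAi, c.hbb, c.haa, c.ones_j, c.ones_i,
    c.ho, c.hl, c.hOo, c.hbo, c.hao, c.hb'l, c.ha'l, c.hOl, c.use⟩

lemma zero_node (c : PairConfig n X li lj o l O A a a' b b') : IsKmNode n X 0 O :=
  (c.zero O).2 rfl

lemma zero_notMem (c : PairConfig n X li lj o l O A a a' b b') {k : Set Pt}
    (hk : k ∈ maxLines n X) : O ∉ k := (isKmNode_zero_iff.1 c.zero_node).2 k hk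

lemma one_ne_zero (c : PairConfig n X li lj o l O A a a' b b') {P : Pt}
    (hP : IsKmNode n X 1 P) : P ≠ O := by
  rintro rfl
  obtain ⟨-, k, hk, hPk, -⟩ := isKmNode_one_iff.1 hP
  exact c.zero_notMem hk hPk

lemma one_a (c : PairConfig n X li lj o l O A a a' b b') : a ∈ li ∧ IsKmNode n X 1 a := by
  have : a ∈ {P ∈ li | IsKmNode n X 1 P} := by rw [c.ones_i]; simp
  exact this

lemma one_a' (c : PairConfig n X li lj o l O A a a' b b') : a' ∈ li ∧ IsKmNode n X 1 a' := by
  have : a' ∈ {P ∈ li | IsKmNode n X 1 P} := by rw [c.ones_i]; simp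
  exact this

lemma eq_or_eq (c : PairConfig n X li lj o l O A a a' b b') {P : Pt} (hP : P ∈ li)
    (h1 : IsKmNode n X 1 P) : P = a ∨ P = a' := by
  have : P ∈ ({a, a'} : Set Pt) := by rw [← c.ones_i]; exact ⟨hP, h1⟩
  exact this

lemma o_notMem (c : PairConfig n X li lj o l O A a a' b b') : o ∉ maxLines n X :=
  fun h => c.zero_notMem h c.hOo

lemma a'_notMem (c : PairConfig n X li lj o l O A a a' b b') : a' ∉ o := fun h =>
  c.o_notMem (by rw [c.ho.ext c.hi.1 c.haa c.hao h c.one_a.1 c.one_a'.1]; exact c.hi)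

lemma l_notMem (c : PairConfig n X li lj o l O A a a' b b') : l ∉ maxLines n X := fun h =>
  c.hij ((c.one_a'.2.eq_of_mem c.hi h c.one_a'.1 c.ha'l).trans
    (c.symm.one_a'.2.eq_of_mem h c.hj c.hb'l c.symm.one_a'.1))

lemma a_notMem (c : PairConfig n X li lj o l O A a a' b b') : a ∉ l := fun h =>
  c.l_notMem (by rw [c.hl.ext c.hi.1 c.haa h c.ha'l c.one_a.1 c.one_a'.1]; exact c.hi)

lemma a'_ne_b' (c : PairConfig n X li lj o l O A a a' b b') : a' ≠ b' := fun h =>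
  c.hij (c.one_a'.2.eq_of_mem c.hi c.hj c.one_a'.1 (h ▸ c.symm.one_a'.1))

lemma inter_subsingleton (c : PairConfig n X li lj o l O A a a' b b') : (o ∩ l).Subsingleton := by
  intro P hP Q hQ
  by_contra hne
  exact c.hOl (by rw [← c.ho.ext c.hl hne hP.1 hQ.1 hP.2 hQ.2]; exact c.hOo)

/-- The point where a maximal line meets `l` is unique. -/
lemma eq_of_mem_l (c : PairConfig n X li lj o l O A a a' b b') {k : Set Pt}
    (hk : k ∈ maxLines n X) {P Q : Pt} (hP : P ∈ k) (hQ : Q ∈ k) (hPl : P ∈ l) (hQl : Q ∈ l) :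
    P = Q := by
  by_contra hne
  exact c.l_notMem (by rw [c.hl.ext hk.1 hne hPl hQl hP hQ]; exact hk)

lemma eq_of_mem_o (c : PairConfig n X li lj o l O A a a' b b') {k : Set Pt}
    (hk : k ∈ maxLines n X) {P Q : Pt} (hP : P ∈ k) (hQ : Q ∈ k) (hPo : P ∈ o) (hQo : Q ∈ o) :
    P = Q := by
  by_contra hne
  exact c.o_notMem (by rw [c.ho.ext hk.1 hne hPo hQo hP hQ]; exact hk)

/-- The `1_m`-nodes on `l` other than `a'` and `b'` are on `o`. -/
lemma one_on_l (c : PairConfig n X li lj o l O A a a' b b') {P : Pt} (hP : IsKmNode n X 1 P)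
    (hPl : P ∈ l) : P = a' ∨ P = b' ∨ P ∈ o := by
  obtain ⟨q, hq, hOq, haq⟩ := exists_line O a' (c.one_ne_zero c.one_a'.2).symm
  obtain ⟨p, hp, hOp, hbp⟩ := exists_line O b' (c.one_ne_zero c.symm.one_a'.2).symm
  by_contra! hc
  obtain ⟨h1, h2, h3⟩ := hc
  have hPq : P ∉ q := fun h => c.hOl (by rw [c.hl.ext hq h1 hPl c.ha'l h haq]; exact hOq)
  have hPp : P ∉ p := fun h => c.hOl (by rw [c.hl.ext hp h2 hPl c.hb'l h hbp]; exact hOp)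
  have hqo : q ≠ o := fun e => c.a'_notMem (e ▸ haq)
  have hpo : p ≠ o := fun e => c.symm.a'_notMem (e ▸ hbp)
  have hpq : p ≠ q := fun e =>
    c.hOl (by rw [c.hl.ext hp c.a'_ne_b' c.ha'l c.hb'l (e ▸ haq) hbp]; exact hOp)
  -- lines through `O` and a `1_m`-node of `li` or `lj`
  have key_i : ∀ k ∈ maxLines n X, k ≠ li → ∃ x ∈ k, IsKmNode n X 1 x ∧ (x ∈ o ∨ x ∈ q) := by
    intro k hk hki
    obtain ⟨g, x, y, hg, hOg, hxg, hyg, hxk, hx, hyi, hy⟩ :=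
      c.two.exists_concurrent hk c.hi hki c.zero_node
    refine ⟨x, hxk, hx, ?_⟩
    rcases c.eq_or_eq hyi hy with rfl | rfl
    · left; rw [c.ho.ext hg (c.one_ne_zero hy) c.hao c.hOo hyg hOg]; exact hxg
    · right; rw [hq.ext hg (c.one_ne_zero hy) haq hOq hyg hOg]; exact hxg
  have key_j : ∀ k ∈ maxLines n X, k ≠ lj → ∃ x ∈ k, IsKmNode n X 1 x ∧ (x ∈ o ∨ x ∈ p) := by
    intro k hk hkj
    obtain ⟨g, x, y, hg, hOg, hxg, hyg, hxk, hx, hyj, hy⟩ :=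
      c.two.exists_concurrent hk c.hj hkj c.zero_node
    refine ⟨x, hxk, hx, ?_⟩
    rcases c.symm.eq_or_eq hyj hy with rfl | rfl
    · left; rw [c.ho.ext hg (c.one_ne_zero hy) c.hbo c.hOo hyg hOg]; exact hxg
    · right; rw [hp.ext hg (c.one_ne_zero hy) hbp hOp hyg hOg]; exact hxg
  -- A maximal line `v` without a `1_m`-node on `o` has its two `1_m`-nodes on `q` and `p`, one on
  -- each.
  obtain ⟨v, hv, hvo⟩ := c.two.exists_not_one c.ho c.zero_node c.hOo
  have hvi : v ≠ li := fun e => hvo a c.hao (e ▸ c.one_a.1) c.one_a.2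
  have hvj : v ≠ lj := fun e => hvo b c.hbo (e ▸ c.symm.one_a.1) c.symm.one_a.2
  obtain ⟨z, hzv, hz, hzq⟩ := key_i v hv hvi
  replace hzq := hzq.resolve_left fun h => hvo z h hzv hz
  obtain ⟨w, hwv, hw, hwp⟩ := key_j v hv hvj
  replace hwp := hwp.resolve_left fun h => hvo w h hwv hw
  have hzw : z ≠ w := by
    rintro rfl
    exact hpq (hp.ext hq (c.one_ne_zero hz) hwp hOp hzq hOq)
  have hzwv : ∀ y ∈ v, IsKmNode n X 1 y → y = z ∨ y = w := by
    obtain ⟨w', hw'v, hw', -, he⟩ := c.two.exists_other hv hzv hz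
    have hww : w = w' := by
      have : w ∈ ({z, w'} : Set Pt) := by rw [← he]; exact ⟨hwv, hw⟩
      exact this.resolve_left hzw.symm
    intro y hy h1
    have : y ∈ ({z, w'} : Set Pt) := by rw [← he]; exact ⟨hy, h1⟩
    rw [hww]
    exact this
  have key_v : ∀ k ∈ maxLines n X, k ≠ v → ∃ x ∈ k, IsKmNode n X 1 x ∧ (x ∈ q ∨ x ∈ p) := by
    intro k hk hkv
    obtain ⟨g, x, y, hg, hOg, hxg, hyg, hxk, hx, hyv, hy⟩ :=
      c.two.exists_concurrent hk hv hkv c.zero_node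
    refine ⟨x, hxk, hx, ?_⟩
    rcases hzwv y hyv hy with rfl | rfl
    · left; rw [hq.ext hg (c.one_ne_zero hy) hzq hOq hyg hOg]; exact hxg
    · right; rw [hp.ext hg (c.one_ne_zero hy) hwp hOp hyg hOg]; exact hxg
  obtain ⟨-, k, hk, hPk, -⟩ := isKmNode_one_iff.1 hP
  have hki : k ≠ li := by
    rintro rfl
    rcases c.eq_or_eq hPk hP with rfl | rfl
    exacts [h3 c.hao, h1 rfl]
  have hkj : k ≠ lj := by
    rintro rfl
    rcases c.symm.eq_or_eq hPk hP with rfl | rfl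
    exacts [h3 c.hbo, h2 rfl]
  have hkv : k ≠ v := by
    rintro rfl
    rcases hzwv P hPk hP with rfl | rfl
    exacts [hPq hzq, hPp hwp]
  obtain ⟨P', -, hP', hPP', he⟩ := c.two.exists_other hk hPk hP
  have huniq : ∀ x ∈ k, IsKmNode n X 1 x → x ≠ P → x = P' := by
    intro x hx h1 hne
    have : x ∈ ({P, P'} : Set Pt) := by rw [← he]; exact ⟨hx, h1⟩
    exact this.resolve_left hne
  -- The line `k` needs a `1_m`-node in each of `o ∪ q`, `o ∪ p`, `q ∪ p`. As `P` is on none of `o`,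
  -- `p`, `q`, all three are `P'`, which thus lies on two different lines through `O`.
  obtain ⟨x, hxk, hx, hx1⟩ := key_i k hk hki
  obtain ⟨y, hyk, hy, hy1⟩ := key_j k hk hkj
  obtain ⟨t, htk, ht, ht1⟩ := key_v k hk hkv
  have ex := huniq x hxk hx (by rintro rfl; tauto)
  have ey := huniq y hyk hy (by rintro rfl; tauto)
  have et := huniq t htk ht (by rintro rfl; tauto)
  rw [ex] at hx1
  rw [ey] at hy1
  rw [et] at ht1
  have d1 : ¬ (P' ∈ q ∧ P' ∈ o) := fun h => hqo (hq.ext c.ho (c.one_ne_zero hP') h.1 hOq h.2 c.hOo)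
  have d2 : ¬ (P' ∈ p ∧ P' ∈ o) := fun h => hpo (hp.ext c.ho (c.one_ne_zero hP') h.1 hOp h.2 c.hOo)
  have d3 : ¬ (P' ∈ p ∧ P' ∈ q) := fun h => hpq (hp.ext hq (c.one_ne_zero hP') h.1 hOp h.2 hOq)
  tauto

/-! ### The lowering: its maximal lines, its defect, and hat nodes. -/

lemma mem_oneLines_left (c : PairConfig n X li lj o l O A a a' b b') : li ∈ oneLines n X l :=
  ⟨c.hi, a', c.ha'l, c.one_a'.1, c.one_a'.2⟩

lemma mem_oneLines_cases (c : PairConfig n X li lj o l O A a a' b b') {k : Set Pt}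
    (hk : k ∈ oneLines n X l) : k = li ∨ k = lj ∨ ∃ S ∈ o ∩ l, S ∈ k ∧ IsKmNode n X 1 S := by
  obtain ⟨hkM, P, hPl, hPk, hP⟩ := hk
  rcases c.one_on_l hP hPl with rfl | rfl | hPo
  · exact Or.inl (hP.eq_of_mem hkM c.hi hPk c.one_a'.1)
  · exact Or.inr (Or.inl (hP.eq_of_mem hkM c.hj hPk c.symm.one_a'.1))
  · exact Or.inr (Or.inr ⟨P, ⟨hPo, hPl⟩, hPk, hP⟩)

lemma lowering_eq (c : PairConfig n X li lj o l O A a a' b b') :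
    lowering n X l = keep n X (oneLines n X l) := IsDefectTwo.lowering_eq c.hl c.l_notMem

lemma gc_lowering (c : PairConfig n X li lj o l O A a a' b b') :
    IsGC (oneLines n X l).ncard (lowering n X l) := by
  rw [c.lowering_eq]
  exact (c.two.keep_spec IsDefectTwo.oneLines_subset).1

lemma one_mem_lowering (c : PairConfig n X li lj o l O A a a' b b') {P : Pt}
    (hP : IsKmNode n X 1 P) {k : Set Pt} (hk : k ∈ oneLines n X l) (hPk : P ∈ k) :
    P ∈ lowering n X l := by
  rw [c.lowering_eq]
  exact IsDefectTwo.one_mem_keep IsDefectTwo.oneLines_subset hk hPk hP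

/-- A maximal line through `P` was kept because it meets `l` at a `1_m`-node, which must be `P`; and
a node on no maximal line is `O`, which is not on `l`. -/
lemma one_of_mem_lowering (c : PairConfig n X li lj o l O A a a' b b') {P : Pt}
    (hP : P ∈ lowering n X l) (hPl : P ∈ l) : IsKmNode n X 1 P := by
  rw [c.lowering_eq, mem_keep] at hP
  by_cases h : ∃ k ∈ maxLines n X, P ∈ k
  · obtain ⟨k, hk, hPk⟩ := h
    obtain ⟨-, Q, hQl, hQk, hQ⟩ := hP.2 k hk hPk
    rwa [c.eq_of_mem_l hk hPk hQk hPl hQl]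
  · push Not at h
    exact absurd hPl ((c.zero P).1 (isKmNode_zero_iff.2 ⟨hP.1, h⟩) ▸ c.hOl)

lemma mem_lowering_iff (c : PairConfig n X li lj o l O A a a' b b') {P : Pt} (hPl : P ∈ l) :
    P ∈ lowering n X l ↔ IsKmNode n X 1 P := by
  refine ⟨fun h => c.one_of_mem_lowering h hPl, fun h => ?_⟩
  obtain ⟨-, k, hk, hPk, -⟩ := isKmNode_one_iff.1 h
  exact c.one_mem_lowering h ⟨hk, P, hPl, hPk, h⟩ hPk

lemma o_mem_maxLines (c : PairConfig n X li lj o l O A a a' b b') :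
    o ∈ maxLines (oneLines n X l).ncard (lowering n X l) := by
  rw [c.lowering_eq]
  refine c.two.mem_maxLines_keep IsDefectTwo.oneLines_subset c.ho c.zero_node c.hOo fun k hk => ?_
  rcases c.mem_oneLines_cases hk with rfl | rfl | ⟨S, hS, hSk, hS1⟩
  exacts [⟨a, c.hao, c.one_a⟩, ⟨b, c.hbo, c.symm.one_a⟩, ⟨S, hS.1, hSk, hS1⟩]

lemma oneLines_mem_maxLines (c : PairConfig n X li lj o l O A a a' b b') {k : Set Pt}
    (hk : k ∈ oneLines n X l) : k ∈ maxLines (oneLines n X l).ncard (lowering n X l) := by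
  rw [c.lowering_eq]
  exact (c.two.keep_spec IsDefectTwo.oneLines_subset).2.1 k hk

lemma finite_oneLines (c : PairConfig n X li lj o l O A a a' b b') : (oneLines n X l).Finite :=
  c.two.finite.subset IsDefectTwo.oneLines_subset

lemma ncard_oneLines_pos (c : PairConfig n X li lj o l O A a a' b b') :
    0 < (oneLines n X l).ncard :=
  (Set.ncard_pos c.finite_oneLines).2 ⟨li, c.mem_oneLines_left⟩

/-- A maximal line of the lowering that is not maximal in `X` and differs from `o` contains `O`
and `a'`. -/
lemma maxLines_lowering_aux (c : PairConfig n X li lj o l O A a a' b b') {g : Set Pt}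
    (hg : g ∈ maxLines (oneLines n X l).ncard (lowering n X l)) (hgK : g ∉ oneLines n X l)
    (hgo : g ≠ o) : O ∈ g ∧ a' ∈ g := by
  have hsub : (↑c.finite_oneLines.toFinset : Set (Set Pt)) ⊆
      maxLines (oneLines n X l).ncard (lowering n X l) := fun k hk =>
    c.oneLines_mem_maxLines (by simpa using hk)
  -- Removing all kept lines leaves degree 0, with `g` still maximal: it contains the one remaining
  -- node, `O`.
  have h0 := (c.gc_lowering.diff_sUnion c.finite_oneLines.toFinset (m := 0)
    (by rw [← Set.ncard_eq_toFinset_card _ c.finite_oneLines, zero_add]) hsub).2.1 g hg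
    (by simpa using hgK)
  rw [Set.Finite.coe_toFinset] at h0
  obtain ⟨Q, hQ⟩ := Set.ncard_eq_one.1 h0.2
  have hQ' : Q ∈ g ∩ (lowering n X l \ ⋃₀ oneLines n X l) := by rw [hQ]; rfl
  have hOg : O ∈ g := by
    have : IsKmNode n X 0 Q := by
      have hQK := hQ'.2.1
      rw [c.lowering_eq, mem_keep] at hQK
      exact isKmNode_zero_iff.2 ⟨hQK.1, fun k hk hQk => hQ'.2.2 ⟨k, hQK.2 k hk hQk, hQk⟩⟩
    rw [← (c.zero Q).1 this]
    exact hQ'.1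
  refine ⟨hOg, ?_⟩
  obtain ⟨P, hP, hPg, hPi⟩ := c.gc_lowering.exists_mem_inter hg
    (c.oneLines_mem_maxLines c.mem_oneLines_left)
  have hgi : g ≠ li := fun e => hgK (e ▸ c.mem_oneLines_left)
  have hP1 : IsKmNode n X 1 P := by
    rw [c.lowering_eq, mem_keep] at hP
    refine isKmNode_one_iff.2 ⟨hP.1, li, c.hi, hPi, fun m hm hPm => ?_⟩
    by_contra hne
    have hmK := hP.2 m hm hPm
    exact c.gc_lowering.not_concurrent c.ncard_oneLines_pos hg
      (c.oneLines_mem_maxLines c.mem_oneLines_left) (c.oneLines_mem_maxLines hmK) hgi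
      (fun e => hgK (e ▸ hmK)) (Ne.symm hne) hPg hPi hPm
  rcases c.eq_or_eq hPi hP1 with rfl | rfl
  · exact absurd (hg.1.ext c.ho (c.one_ne_zero hP1) hPg hOg c.hao c.hOo) hgo
  · exact hPg

/-- A further maximal line would contain `O`, `a'` and `b'`, so `l` would contain `O`. -/
lemma maxLines_lowering (c : PairConfig n X li lj o l O A a a' b b') :
    maxLines (oneLines n X l).ncard (lowering n X l) = insert o (oneLines n X l) := by
  ext g
  constructor
  · intro hg
    by_contra hne
    rw [Set.mem_insert_iff, not_or] at hne
    obtain ⟨h1, h2⟩ := c.maxLines_lowering_aux hg hne.2 hne.1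
    have h3 : b' ∈ g := (c.symm.maxLines_lowering_aux hg hne.2 hne.1).2
    exact c.hOl (by rw [c.hl.ext hg.1 c.a'_ne_b' c.ha'l c.hb'l h2 h3]; exact h1)
  · rintro (rfl | hg)
    exacts [c.o_mem_maxLines, c.oneLines_mem_maxLines hg]

lemma o_notMem_oneLines (c : PairConfig n X li lj o l O A a a' b b') : o ∉ oneLines n X l :=
  fun h => c.o_notMem h.1

lemma defect_lowering (c : PairConfig n X li lj o l O A a a' b b') :
    defect (oneLines n X l).ncard (lowering n X l) = 1 := by
  unfold defect
  rw [c.maxLines_lowering, Set.ncard_insert_of_notMem c.o_notMem_oneLines c.finite_oneLines]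
  push_cast
  ring

lemma l_ne_o (c : PairConfig n X li lj o l O A a a' b b') : l ≠ o := fun e =>
  c.hOl (e ▸ c.hOo)

lemma l_notMem_maxLines (c : PairConfig n X li lj o l O A a a' b b') :
    l ∉ maxLines (oneLines n X l).ncard (lowering n X l) := by
  rw [c.maxLines_lowering]
  rintro (h | h)
  exacts [c.l_ne_o h, c.l_notMem h.1]

lemma not_isProper (c : PairConfig n X li lj o l O A a a' b b') : ¬ IsProper n X l := by
  rintro ⟨-, -, m, hm, hlm⟩
  rw [hm.degree_unique c.gc_lowering.1] at hlm
  exact c.l_notMem_maxLines hlm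

lemma ncard_inter_bounds (c : PairConfig n X li lj o l O A a a' b b') {g : Set Pt} (hg : IsLine g)
    (hgM : g ∉ maxLines n X) {P Q : Pt} (hPQ : P ≠ Q) (hP : P ∈ g ∩ X) (hQ : Q ∈ g ∩ X) :
    2 ≤ (g ∩ X).ncard ∧ (g ∩ X).ncard ≤ n := by
  have h1 := c.two.gc.ncard_inter_le hg
  have h2 : (g ∩ X).ncard ≠ n + 1 := fun h => hgM ⟨hg, h⟩
  refine ⟨?_, by omega⟩
  rw [← Set.ncard_pair hPQ]
  refine Set.ncard_le_ncard ?_ (c.two.gc.finite.subset Set.inter_subset_right)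
  rintro _ (rfl | rfl)
  exacts [hP, hQ]

/-- The `o`-lowering keeps by construction the maximal lines that `o` meets at `1_m`-nodes, so
`mem_maxLines_keep` applies. -/
lemma isProper_o (c : PairConfig n X li lj o l O A a a' b b') : IsProper n X o := by
  obtain ⟨h1, h2⟩ := c.ncard_inter_bounds c.ho c.o_notMem (c.one_ne_zero c.one_a.2)
    ⟨c.hao, c.one_a.2.1⟩ ⟨c.hOo, c.zero_node.1⟩
  refine ⟨h1, h2, (oneLines n X o).ncard, ?_⟩
  rw [IsDefectTwo.lowering_eq c.ho c.o_notMem]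
  exact ⟨(c.two.keep_spec IsDefectTwo.oneLines_subset).1.1,
    c.two.mem_maxLines_keep IsDefectTwo.oneLines_subset c.ho c.zero_node c.hOo fun k hk => hk.2⟩

/-- A lowering node on `l` is a `1_m`-node of `X`; it can lie on two maximal lines of the lowering
only if one is the new line `o`. -/
lemma mem_of_isHatTwoNode (c : PairConfig n X li lj o l O A a a' b b') {P : Pt}
    (hP : IsHatTwoNode n X l P) : P ∈ o ∩ l := by
  obtain ⟨-, -, hPl, m, hm, hP2⟩ := hP
  rw [hm.degree_unique c.gc_lowering.1] at hP2
  refine ⟨?_, hPl⟩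
  by_contra hPo
  have h1 := c.one_of_mem_lowering hP2.1 hPl
  obtain ⟨u, v, huv, he⟩ := Set.encard_eq_two.1 hP2.2
  have hu : u ∈ {k ∈ maxLines (oneLines n X l).ncard (lowering n X l) | P ∈ k} := by rw [he]; simp
  have hv : v ∈ {k ∈ maxLines (oneLines n X l).ncard (lowering n X l) | P ∈ k} := by rw [he]; simp
  rw [c.maxLines_lowering] at hu hv
  have hu' := hu.1.resolve_left fun e => hPo (e ▸ hu.2)
  have hv' := hv.1.resolve_left fun e => hPo (e ▸ hv.2)
  exact huv (h1.eq_of_mem hu'.1 hv'.1 hu.2 hv.2)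

lemma one_tfae (c : PairConfig n X li lj o l O A a a' b b') {S : Pt} (hS : S ∈ o ∩ l) :
    [S ∈ lowering n X l, IsKmNode n X 1 S, IsHatTwoNode n X l S,
      ∃ k ∈ maxLines n X, k ∈ maxLines (oneLines n X l).ncard (lowering n X l) ∧
        o ∩ k = {S}].TFAE := by
  tfae_have 1 ↔ 2 := c.mem_lowering_iff hS.2
  tfae_have 2 → 4 := by
    intro h
    obtain ⟨-, k, hk, hSk, -⟩ := isKmNode_one_iff.1 h
    refine ⟨k, hk, c.oneLines_mem_maxLines ⟨hk, S, hS.2, hSk, h⟩, ?_⟩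
    exact Set.eq_singleton_iff_unique_mem.2
      ⟨⟨hS.1, hSk⟩, fun P hP => c.eq_of_mem_o hk hP.2 hSk hP.1 hS.1⟩
  -- Two maximal lines of the lowering meet at one of its nodes, here necessarily `S`.
  tfae_have 4 → 1 := by
    rintro ⟨k, -, hk, hok⟩
    obtain ⟨P, hP, hPo, hPk⟩ := c.gc_lowering.exists_mem_inter c.o_mem_maxLines hk
    have : P ∈ o ∩ k := ⟨hPo, hPk⟩
    rw [hok] at this
    rwa [← Set.mem_singleton_iff.1 this]
  tfae_have 3 → 1 := by
    rintro ⟨-, -, -, m, -, h⟩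
    exact h.1
  tfae_have 2 → 3 := by
    intro h
    refine ⟨c.l_notMem, c.not_isProper, hS.2, _, c.gc_lowering.1, (c.mem_lowering_iff hS.2).2 h, ?_⟩
    obtain ⟨-, k, hk, hSk, hu⟩ := isKmNode_one_iff.1 h
    have hok : o ≠ k := fun e => c.o_notMem (e ▸ hk)
    rw [c.maxLines_lowering, Nat.cast_ofNat, ← Set.encard_pair hok]
    congr 1
    ext m
    constructor
    · rintro ⟨rfl | hm, hSm⟩
      · simp
      · exact Or.inr (hu m hm.1 hSm)
    · rintro (rfl | rfl)
      · exact ⟨by simp, hS.1⟩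
      · exact ⟨Or.inr ⟨hk, S, hS.2, hSk, h⟩, hSk⟩
  tfae_finish

lemma oneLines_eq_pair (c : PairConfig n X li lj o l O A a a' b b')
    (hS : ∀ S ∈ o ∩ l, ¬ IsKmNode n X 1 S) : oneLines n X l = {li, lj} := by
  ext k
  constructor
  · intro hk
    rcases c.mem_oneLines_cases hk with h | h | ⟨S, hSol, -, hS1⟩
    exacts [Or.inl h, Or.inr h, absurd hS1 (hS S hSol)]
  · rintro (rfl | rfl)
    exacts [c.mem_oneLines_left, c.symm.mem_oneLines_left]

lemma ne_of_mem (c : PairConfig n X li lj o l O A a a' b b') {S : Pt} (hS : S ∈ o ∩ l)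
    (h1 : IsKmNode n X 1 S) {k : Set Pt} (hSk : S ∈ k) : k ≠ li := by
  rintro rfl
  rcases c.eq_or_eq hSk h1 with rfl | rfl
  exacts [c.a_notMem hS.2, c.a'_notMem hS.1]

lemma oneLines_eq_triple (c : PairConfig n X li lj o l O A a a' b b') {S : Pt} (hS : S ∈ o ∩ l)
    (h1 : IsKmNode n X 1 S) {k : Set Pt} (hk : k ∈ maxLines n X) (hSk : S ∈ k) :
    oneLines n X l = {k, li, lj} := by
  ext m
  constructor
  · intro hm
    rcases c.mem_oneLines_cases hm with h | h | ⟨T, hT, hTm, hT1⟩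
    · simp [h]
    · simp [h]
    · rw [c.inter_subsingleton hT hS] at hTm
      exact Or.inl (h1.eq_of_mem hm.1 hk hTm hSk)
  · rintro (rfl | rfl | rfl)
    exacts [⟨hk, S, hS.2, hSk, h1⟩, c.mem_oneLines_left, c.symm.mem_oneLines_left]

lemma ncard_oneLines_triple (c : PairConfig n X li lj o l O A a a' b b') {S : Pt}
    (hS : S ∈ o ∩ l) (h1 : IsKmNode n X 1 S) : (oneLines n X l).ncard = 3 := by
  obtain ⟨-, k, hk, hSk, -⟩ := isKmNode_one_iff.1 h1
  rw [c.oneLines_eq_triple hS h1 hk hSk]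
  exact Set.ncard_eq_three.2 ⟨k, li, lj, c.ne_of_mem hS h1 hSk, c.symm.ne_of_mem hS h1 hSk,
    c.hij, rfl⟩

lemma node_cases (c : PairConfig n X li lj o l O A a a' b b') {P : Pt} (hP : P ∈ X) :
    P = O ∨ IsKmNode n X 1 P ∨ ∃ k m, k ∈ maxLines n X ∧ m ∈ maxLines n X ∧ k ≠ m ∧
      P ∈ k ∧ P ∈ m := by
  by_cases h : ∃ k ∈ maxLines n X, P ∈ k
  · obtain ⟨k, hk, hPk⟩ := h
    by_cases h1 : ∀ m ∈ maxLines n X, P ∈ m → m = k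
    · exact Or.inr (Or.inl (isKmNode_one_iff.2 ⟨hP, k, hk, hPk, h1⟩))
    · push Not at h1
      obtain ⟨m, hm, hPm, hmk⟩ := h1
      exact Or.inr (Or.inr ⟨k, m, hk, hm, hmk.symm, hPk, hPm⟩)
  · push Not at h
    exact Or.inl ((c.zero P).1 (isKmNode_zero_iff.2 ⟨hP, h⟩))

/-! ### The only node that uses `l`. -/

/-- A conic used by the intersection of `li` and a line through a `1_m`-node on `o` and `l` does
not contain `l`. -/
lemma conic_false (c : PairConfig n X li lj o l O A a a' b b') {g k : Set Pt} (hg : IsLine g)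
    (hk : k ∈ maxLines n X) (hOg : O ∈ g) {x x' y y' : Pt} (hx : x ∈ li ∧ IsKmNode n X 1 x)
    (hx' : x' ∈ li) (hy : y ∈ k) (hy' : y' ∈ k)
    (hxx : x ≠ x') (hyy : y ≠ y') (hxg : x ∈ g) (hyg : y ∈ g) (hx'l : x' ∈ l) (hy'l : y' ∈ l)
    {S : Pt} (hS : S ∈ o ∩ l) (hSk : S ∈ k) : False := by
  -- Here `x' = a'` forces `x = a`, hence `g = o`; then `y` and `y'` are both the point `S` of `k`.
  have e1 : x' = a' := c.eq_of_mem_l c.hi hx' c.one_a'.1 hx'l c.ha'l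
  have e2 : x = a := (c.eq_or_eq hx.1 hx.2).resolve_right fun e => hxx (e.trans e1.symm)
  have e3 : y' = S := c.eq_of_mem_l hk hy' hSk hy'l hS.2
  subst e2 e3
  have e4 : g = o := hg.ext c.ho (c.one_ne_zero hx.2) hxg hOg c.hao c.hOo
  rw [e4] at hyg
  exact hyy (c.eq_of_mem_o hk hy hy' hyg hS.1)

/-- `O` uses no non-maximal line, and a `1_m`-node only one, through `O`. For a `2_m`-node, `l` must
be the conic component off `O`, so both maximal lines belong to `oneLines`; `conic_false` excludes
the pairs containing `λ*`. -/
lemma usingNodes_eq (c : PairConfig n X li lj o l O A a a' b b') : usingNodes n X l = {A} := by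
  refine Set.eq_singleton_iff_unique_mem.2
    ⟨(c.use l c.hl c.l_notMem).2 (Or.inr rfl), fun B hB => ?_⟩
  have hBX : B ∈ X := hB.1
  rcases c.node_cases hBX with rfl | h1 | ⟨k, m, hk, hm, hkm, hBk, hBm⟩
  · obtain ⟨hgc, -, hu⟩ := c.two.keep_spec (K := ∅) (Set.empty_subset _)
    have hBK : B ∈ keep n X ∅ := IsDefectTwo.zero_mem_keep c.zero_node
    rw [hu B hBK l c.hl c.l_notMem, Set.ncard_empty] at hB
    rw [Set.ncard_empty] at hgc
    obtain ⟨ls, hls⟩ := hgc.exists_cover hBK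
    obtain ⟨i, -⟩ := (hls.mem_usingNodes_iff hgc.1 hBK c.hl).1 hB
    exact i.elim0
  · obtain ⟨-, k, hk, hBk, -⟩ := isKmNode_one_iff.1 h1
    have hkM : {k} ⊆ maxLines n X := by simpa using hk
    obtain ⟨hgc, -, hu⟩ := c.two.keep_spec hkM
    have hBK : B ∈ keep n X {k} := IsDefectTwo.one_mem_keep hkM rfl hBk h1
    rw [hu B hBK l c.hl c.l_notMem, Set.ncard_singleton] at hB
    rw [Set.ncard_singleton] at hgc
    obtain ⟨ls, hls⟩ := hgc.exists_cover hBK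
    obtain ⟨i, hi⟩ := (hls.mem_usingNodes_iff hgc.1 hBK c.hl).1 hB
    obtain ⟨j, hj⟩ := hls.2.2 O (IsDefectTwo.zero_mem_keep c.zero_node) (c.one_ne_zero h1).symm
    rw [Subsingleton.elim j i, hi] at hj
    exact absurd hj c.hOl
  · obtain ⟨g, h, x, x', y, y', hg, -, hOg, hxx, hyy, hx, hy, hxg, hyg, hxh, hyh, hu⟩ :=
      c.two.exists_conic hk hm hkm c.zero_node hBX hBk hBm
    have hgl : l ≠ g := fun e => c.hOl (e ▸ hOg)
    have hhl := ((hu l c.hl c.l_notMem).1 hB).resolve_left hgl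
    subst hhl
    have x1 : x ∈ {P ∈ k | IsKmNode n X 1 P} := by rw [hx]; simp
    have x2 : x' ∈ {P ∈ k | IsKmNode n X 1 P} := by rw [hx]; simp
    have y1 : y ∈ {P ∈ m | IsKmNode n X 1 P} := by rw [hy]; simp
    have y2 : y' ∈ {P ∈ m | IsKmNode n X 1 P} := by rw [hy]; simp
    have hAB : k = li → m = lj → B = A := by
      rintro rfl rfl
      by_contra hne
      exact hkm (hk.1.ext hm.1 hne hBk c.hAi hBm c.hAj)
    have hAB' : k = lj → m = li → B = A := by
      rintro rfl rfl
      by_contra hne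
      exact hkm (hk.1.ext hm.1 hne hBk c.hAj hBm c.hAi)
    rcases c.mem_oneLines_cases ⟨hk, x', hxh, x2⟩ with hki | hkj | ⟨S, hS, hSk, hS1⟩ <;>
    rcases c.mem_oneLines_cases ⟨hm, y', hyh, y2⟩ with hmi | hmj | ⟨T, hT, hTm, hT1⟩
    · exact absurd (hki.trans hmi.symm) hkm
    · exact hAB hki hmj
    · subst hki
      exact (c.conic_false hg hm hOg x1 x2.1 y1.1 y2.1 hxx hyy hxg hyg hxh hyh hT hTm).elim
    · exact hAB' hkj hmi
    · exact absurd (hkj.trans hmj.symm) hkm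
    · subst hkj
      exact (c.symm.conic_false hg hm hOg x1 x2.1 y1.1 y2.1 hxx hyy hxg hyg hxh hyh hT hTm).elim
    · subst hmi
      exact (c.conic_false hg hk hOg y1 y2.1 x1.1 x2.1 hyy hxx hyg hxg hyh hxh hS hSk).elim
    · subst hmj
      exact (c.symm.conic_false hg hk hOg y1 y2.1 x1.1 x2.1 hyy hxx hyg hxg hyh hxh hS hSk).elim
    · rw [c.inter_subsingleton hT hS] at hTm
      exact absurd (hS1.eq_of_mem hk hm hSk hTm) hkm

/-! ### The `(-1)` disjoint or adjoint item. -/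

lemma inter_lowering_diff (c : PairConfig n X li lj o l O A a a' b b') {C : Set Pt}
    (hoC : o ∩ l ∩ lowering n X l ⊆ C) (ha : a' ∉ C) (hb : b' ∉ C) :
    (l ∩ (lowering n X l \ C)).ncard = 2 := by
  have : l ∩ (lowering n X l \ C) = {a', b'} := by
    ext P
    constructor
    · rintro ⟨hPl, hP, hPC⟩
      rcases c.one_on_l (c.one_of_mem_lowering hP hPl) hPl with h | h | h
      exacts [Or.inl h, Or.inr h, absurd (hoC ⟨⟨h, hPl⟩, hP⟩) hPC]
    · rintro (rfl | rfl)
      · exact ⟨c.ha'l, (c.mem_lowering_iff c.ha'l).2 c.one_a'.2, ha⟩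
      · exact ⟨c.hb'l, (c.mem_lowering_iff c.hb'l).2 c.symm.one_a'.2, hb⟩
  rw [this, Set.ncard_pair c.a'_ne_b']

lemma a'_notMem_third (c : PairConfig n X li lj o l O A a a' b b') {S : Pt} (hS : S ∈ o ∩ l)
    {k : Set Pt} (hk : k ∈ maxLines n X) (hSk : S ∈ k) : a' ∉ k := fun h =>
  c.a'_notMem (by rw [c.eq_of_mem_l hk h hSk c.ha'l hS.2]; exact hS.1)

lemma l_bounds (c : PairConfig n X li lj o l O A a a' b b') :
    2 ≤ (l ∩ X).ncard ∧ (l ∩ X).ncard ≤ n :=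
  c.ncard_inter_bounds c.hl c.l_notMem c.a'_ne_b' ⟨c.ha'l, c.one_a'.2.1⟩
    ⟨c.hb'l, c.symm.one_a'.2.1⟩

lemma ncard_oneLines_pair (c : PairConfig n X li lj o l O A a a' b b')
    (hS : ∀ S ∈ o ∩ l, ¬ IsKmNode n X 1 S) : (oneLines n X l).ncard = 2 := by
  rw [c.oneLines_eq_pair hS, Set.ncard_pair c.hij]

lemma isProperMinus_one (c : PairConfig n X li lj o l O A a a' b b') : IsProperMinus 1 n X l := by
  have hgc := c.gc_lowering.1
  have hlM := c.l_notMem_maxLines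
  have hoM := c.o_mem_maxLines
  by_cases hS : ∀ S ∈ o ∩ l, ¬ IsKmNode n X 1 S
  · rw [c.ncard_oneLines_pair hS] at hgc hlM hoM
    have hemp : o ∩ l ∩ lowering n X l = ∅ :=
      Set.eq_empty_iff_forall_notMem.2 fun P hP => hS P hP.1 ((c.mem_lowering_iff hP.1.2).1 hP.2)
    refine ⟨[o], rfl, c.l_bounds.1, c.l_bounds.2, 2, hgc, ?_⟩
    -- Degree 2 drops to 1, and `a'`, `b'` are the `1 + 1` nodes that make `l` maximal.
    exact DAChain.disjoint (m := 1) hlM ⟨hoM, hemp⟩ (DAChain.nil ⟨c.hl,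
      c.inter_lowering_diff (by simp [hemp]) c.a'_notMem c.symm.a'_notMem⟩)
  · push Not at hS
    obtain ⟨S, hS, hS1⟩ := hS
    obtain ⟨-, k, hk, hSk, -⟩ := isKmNode_one_iff.1 hS1
    have hkM := c.oneLines_mem_maxLines ⟨hk, S, hS.2, hSk, hS1⟩
    rw [c.ncard_oneLines_triple hS hS1] at hgc hlM hoM hkM
    refine ⟨[o ∪ k], rfl, c.l_bounds.1, c.l_bounds.2, 3, hgc, ?_⟩
    -- Degree 3 drops to 1; `S` disappears with `o`, leaving `a'` and `b'` on `l`.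
    refine DAChain.adjoint (m := 1) hlM ⟨hoM, hkM, fun e => c.o_notMem (e ▸ hk), c.l_ne_o.symm,
      fun e => c.l_notMem (e ▸ hk), S, ⟨⟨hS.1, hSk⟩, hS.2⟩, (c.mem_lowering_iff hS.2).2 hS1⟩
      (DAChain.nil ⟨c.hl, c.inter_lowering_diff (fun P hP => Or.inl hP.1.1) ?_ ?_⟩)
    · exact fun h => h.elim c.a'_notMem (c.a'_notMem_third hS hk hSk)
    · exact fun h => h.elim c.symm.a'_notMem (c.symm.a'_notMem_third hS hk hSk)

lemma _root_.GCPlane.DAChain.single {l Y C : Set Pt} {m : ℕ} (h : DAChain l m Y [C]) :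
    IsDisjointLine m Y l C ∨ ∃ c d, IsAdjointPair m Y l c d ∧ C = c ∪ d := by
  cases h with
  | disjoint _ hc _ => exact Or.inl hc
  | adjoint _ hc _ => exact Or.inr ⟨_, _, hc, rfl⟩

/-- A line of `oneLines` meets `l` at a node of the lowering, so it is never disjoint, and two such
lines share no `1_m`-node. Every item therefore involves `o`. -/
lemma item_cases (c : PairConfig n X li lj o l O A a a' b b') {C : Set Pt}
    (hC : HasDAItems n X l [C]) : (C = o ∧ ∀ S ∈ o ∩ l, ¬ IsKmNode n X 1 S) ∨
      ∃ k ∈ maxLines n X, ∃ S ∈ o ∩ l, IsKmNode n X 1 S ∧ S ∈ k ∧ C = o ∪ k := by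
  obtain ⟨-, -, m, hm, hch⟩ := hC
  rw [hm.degree_unique c.gc_lowering.1] at hch
  rcases hch.single with ⟨hCM, hemp⟩ | ⟨d, e, ⟨hd, he, hde, -, -, P, ⟨⟨hPd, hPe⟩, hPl⟩, hP⟩, rfl⟩
  · rw [c.maxLines_lowering] at hCM
    rcases hCM with rfl | ⟨hCM, P, hPl, hPC, hP⟩
    · refine Or.inl ⟨rfl, fun S hS hS1 => ?_⟩
      have : S ∈ C ∩ l ∩ lowering n X l := ⟨hS, (c.mem_lowering_iff hS.2).2 hS1⟩
      rw [hemp] at this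
      exact this
    · have : P ∈ C ∩ l ∩ lowering n X l := ⟨⟨hPC, hPl⟩, (c.mem_lowering_iff hPl).2 hP⟩
      rw [hemp] at this
      exact this.elim
  · rw [c.maxLines_lowering] at hd he
    have hP1 := (c.mem_lowering_iff hPl).1 hP
    right
    rcases hd with rfl | hd <;> rcases he with rfl | he
    · exact absurd rfl hde
    · exact ⟨e, he.1, P, ⟨hPd, hPl⟩, hP1, hPe, rfl⟩
    · exact ⟨d, hd.1, P, ⟨hPe, hPl⟩, hP1, hPd, Set.union_comm _ _⟩
    · exact absurd (hP1.eq_of_mem hd.1 he.1 hPd hPe) hde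

lemma A_not_one (c : PairConfig n X li lj o l O A a a' b b') : ¬ IsKmNode n X 1 A := fun h =>
  c.hij (h.eq_of_mem c.hi c.hj c.hAi c.hAj)

/-- Assumption `hk` places `P` off `λ*`. Of the lowering nodes on `li`, `a` is on `o` and `a'` on
`l`, so `P` must also lie on `lj`. -/
lemma eq_A_of_mem_left (c : PairConfig n X li lj o l O A a a' b b') {P : Pt}
    (hP : P ∈ lowering n X l) (hPo : P ∉ o) (hPl : P ∉ l)
    (hk : ∀ k ∈ maxLines n X, ∀ S ∈ o ∩ l, IsKmNode n X 1 S → S ∈ k → P ∉ k) (hPi : P ∈ li) :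
    P = A := by
  rw [c.lowering_eq, mem_keep] at hP
  rcases c.node_cases hP.1 with rfl | h1 | ⟨k, m, hkM, hmM, hkm, hPk, hPm⟩
  · exact absurd c.hOo hPo
  · rcases c.eq_or_eq hPi h1 with rfl | rfl
    exacts [absurd c.hao hPo, absurd c.ha'l hPl]
  · have key : ∀ k ∈ maxLines n X, P ∈ k → k = li ∨ k = lj := fun k hkM hPk => by
      rcases c.mem_oneLines_cases (hP.2 k hkM hPk) with h | h | ⟨S, hS, hSk, hS1⟩
      exacts [Or.inl h, Or.inr h, absurd hPk (hk k hkM S hS hS1 hSk)]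
    have hPj : P ∈ lj := by
      rcases key k hkM hPk with rfl | rfl
      · rcases key m hmM hPm with rfl | rfl
        exacts [absurd rfl hkm, hPm]
      · exact hPk
    by_contra hne
    exact c.hij (c.hi.1.ext c.hj.1 hne hPi c.hAi hPj c.hAj)

lemma lowering_diff_eq (c : PairConfig n X li lj o l O A a a' b b') {C : Set Pt}
    (hC : HasDAItems n X l [C]) : lowering n X l \ (C ∪ l) = {A} := by
  have hC' := c.item_cases hC
  have hAX : A ∈ lowering n X l := by
    rw [c.lowering_eq, mem_keep]
    refine ⟨c.hA, fun k hk hAk => ?_⟩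
    by_contra hne
    exact c.two.gc.not_concurrent c.two.pos hk c.hi c.hj
      (fun e => hne (e ▸ c.mem_oneLines_left)) (fun e => hne (e ▸ c.symm.mem_oneLines_left))
      c.hij hAk c.hAi c.hAj
  have hAo : A ∉ o := fun h => c.A_not_one
    (by rw [c.eq_of_mem_o c.hi c.hAi c.one_a.1 h c.hao]; exact c.one_a.2)
  have hAl : A ∉ l := fun h => c.A_not_one
    (by rw [c.eq_of_mem_l c.hi c.hAi c.one_a'.1 h c.ha'l]; exact c.one_a'.2)
  refine Set.eq_singleton_iff_unique_mem.2 ⟨⟨hAX, ?_⟩, ?_⟩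
  · rintro (h | h)
    · rcases hC' with ⟨rfl, -⟩ | ⟨k, hk, S, hS, hS1, hSk, rfl⟩
      · exact hAo h
      · rcases h with h | h
        · exact hAo h
        · exact c.two.gc.not_concurrent c.two.pos hk c.hi c.hj (c.ne_of_mem hS hS1 hSk)
            (c.symm.ne_of_mem hS hS1 hSk) c.hij h c.hAi c.hAj
    · exact hAl h
  · rintro P ⟨hP, hPC⟩
    rw [Set.mem_union, not_or] at hPC
    have hPo : P ∉ o := by
      rcases hC' with ⟨rfl, -⟩ | ⟨k, hk, S, hS, hS1, hSk, rfl⟩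
      exacts [hPC.1, fun h => hPC.1 (Or.inl h)]
    have hthird : ∀ k ∈ maxLines n X, ∀ S ∈ o ∩ l, IsKmNode n X 1 S → S ∈ k → P ∉ k := by
      intro m hm T hT hT1 hTm hPm
      rcases hC' with ⟨rfl, hn⟩ | ⟨k, hk, S, hS, hS1, hSk, rfl⟩
      · exact hn T hT hT1
      · rw [c.inter_subsingleton hT hS] at hTm
        rw [hS1.eq_of_mem hm hk hTm hSk] at hPm
        exact hPC.1 (Or.inr hPm)
    have hPX : P ∈ X := hP.1
    have hPn : ¬ ∀ k ∈ maxLines n X, P ∉ k := fun h =>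
      hPo ((c.zero P).1 (isKmNode_zero_iff.2 ⟨hPX, h⟩) ▸ c.hOo)
    push Not at hPn
    obtain ⟨k, hk, hPk⟩ := hPn
    have hP' := hP
    rw [c.lowering_eq, mem_keep] at hP'
    rcases c.mem_oneLines_cases (hP'.2 k hk hPk) with rfl | rfl | ⟨S, hS, hSk, hS1⟩
    · exact c.eq_A_of_mem_left hP hPo hPC.2 hthird hPk
    · exact c.symm.eq_A_of_mem_left hP hPo hPC.2 hthird hPk
    · exact absurd hPk (hthird k hk S hS hS1 hSk)

/-! ### Well-definedness of `o` and `l`, the role of `n_ij = 3`, and the conclusion. -/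

lemma isLinePair (c : PairConfig n X li lj o l O A a a' b b') : IsLinePair n X li lj o l :=
  ⟨a, a', b, b', c.haa, c.hbb, c.ones_i, c.ones_j,
    ⟨c.ho, ⟨O, c.hOo, c.zero_node⟩, a, c.hao, c.one_a.2⟩, c.hao, c.hbo, c.hl, c.ha'l, c.hb'l⟩

/-- A labelling with `x = a'` fails: `y = b` would put `a'` on `o`, and `y = b'` would put `O` on
`l`. -/
lemma eq_of_isLinePair (c : PairConfig n X li lj o l O A a a' b b') {o' l' : Set Pt}
    (h : IsLinePair n X li lj o' l') : o' = o ∧ l' = l := by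
  obtain ⟨x, x', y, y', hxx, hyy, hx, hy, ho', hxo, hyo, hl', hxl, hyl⟩ := h
  have hOo' := ho'.mem_zero c.zero
  have x1 : x ∈ li ∧ IsKmNode n X 1 x := by
    have : x ∈ {P ∈ li | IsKmNode n X 1 P} := by rw [hx]; simp
    exact this
  have x2 : x' ∈ li ∧ IsKmNode n X 1 x' := by
    have : x' ∈ {P ∈ li | IsKmNode n X 1 P} := by rw [hx]; simp
    exact this
  have y1 : y ∈ lj ∧ IsKmNode n X 1 y := by
    have : y ∈ {P ∈ lj | IsKmNode n X 1 P} := by rw [hy]; simp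
    exact this
  have y2 : y' ∈ lj ∧ IsKmNode n X 1 y' := by
    have : y' ∈ {P ∈ lj | IsKmNode n X 1 P} := by rw [hy]; simp
    exact this
  have hxa : x = a := by
    by_contra hne
    have e := (c.eq_or_eq x1.1 x1.2).resolve_left hne
    rcases c.symm.eq_or_eq y1.1 y1.2 with e' | e'
    · have : o' = o := ho'.1.ext c.ho (c.one_ne_zero y1.2) hyo hOo' (e' ▸ c.hbo) c.hOo
      exact c.a'_notMem (this ▸ e ▸ hxo)
    · have : o' = l := ho'.1.ext c.hl c.a'_ne_b' (e ▸ hxo) (e' ▸ hyo) c.ha'l c.hb'l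
      exact c.hOl (this ▸ hOo')
  have hoo : o' = o := ho'.1.ext c.ho (c.one_ne_zero x1.2) hxo hOo' (hxa ▸ c.hao) c.hOo
  have hyb : y = b := (c.symm.eq_or_eq y1.1 y1.2).resolve_right fun e =>
    c.symm.a'_notMem (by rw [← e, ← hoo]; exact hyo)
  have hxa' : x' = a' := (c.eq_or_eq x2.1 x2.2).resolve_left fun e => hxx (hxa.trans e.symm)
  have hyb' : y' = b' := (c.symm.eq_or_eq y2.1 y2.2).resolve_left fun e => hyy (hyb.trans e.symm)
  exact ⟨hoo, hl'.ext c.hl c.a'_ne_b' (hxa' ▸ hxl) (hyb' ▸ hyl) c.ha'l c.hb'l⟩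

end PairConfig

/-- If both components of the conic of `A` contained `O`, they would be the only `O`-lines meeting
the four `1_m`-nodes, against `n_ij = 3`. -/
lemma IsDefectTwo.exists_pairConfig {n : ℕ} {X li lj : Set Pt} (h : IsDefectTwo n X)
    (hi : li ∈ maxLines n X) (hj : lj ∈ maxLines n X) (hij : li ≠ lj)
    (hnij : oLineCount n X li lj = 3) :
    ∃ o l O A a a' b b', PairConfig n X li lj o l O A a a' b b' := by
  obtain ⟨O, hO⟩ := h.existsUnique_zero
  obtain ⟨A, hA, hAi, hAj⟩ := h.gc.exists_mem_inter hi hj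
  obtain ⟨g, k, x, x', y, y', hg, hk, hOg, hxx, hyy, hx, hy, hxg, hyg, hxk, hyk, hu⟩ :=
    h.exists_conic hi hj hij ((hO O).2 rfl) hA hAi hAj
  refine ⟨g, k, O, A, x, x', y, y', h, hi, hj, hij, hO, hA, hAi, hAj, hxx, hyy, hx, hy, hg, hk,
    hOg, hxg, hyg, hxk, hyk, fun hOk => ?_, hu⟩
  have hsub : {o | IsOLine n X o ∧ ∃ P ∈ o, IsKmNode n X 1 P ∧ (P ∈ li ∨ P ∈ lj)} ⊆ {g, k} := by
    rintro o ⟨ho, P, hPo, hP, hPij⟩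
    have hOo := ho.mem_zero hO
    have hPO : P ≠ O := by
      rintro rfl
      have h0 := isKmNode_zero_iff.1 ((hO P).2 rfl)
      exact hPij.elim (h0.2 li hi) (h0.2 lj hj)
    have hgk : P ∈ g ∨ P ∈ k := by
      rcases hPij with hPi | hPj
      · have : P ∈ ({x, x'} : Set Pt) := by rw [← hx]; exact ⟨hPi, hP⟩
        rcases this with rfl | rfl
        exacts [Or.inl hxg, Or.inr hxk]
      · have : P ∈ ({y, y'} : Set Pt) := by rw [← hy]; exact ⟨hPj, hP⟩
        rcases this with rfl | rfl
        exacts [Or.inl hyg, Or.inr hyk]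
    rcases hgk with hPg | hPk
    · exact Or.inl (ho.1.ext hg hPO hPo hOo hPg hOg)
    · exact Or.inr (ho.1.ext hk hPO hPo hOo hPk hOk)
  have h1 := Set.ncard_le_ncard hsub
  have h2 := Set.ncard_insert_le g {k}
  rw [Set.ncard_singleton] at h2
  unfold oLineCount at hnij
  omega

/-- Needed because for `n = 0` the maximal lines form an infinite family, whose `ncard` is 0, so the
defect is formally 2. But then no `1_m`-node exists, as `li` and `lj` share the only node. -/
lemma pos_of_oLineCount {n : ℕ} {X li lj : Set Pt} (hX : IsGC n X)
    (hi : li ∈ maxLines n X) (hj : lj ∈ maxLines n X) (hij : li ≠ lj)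
    (hnij : oLineCount n X li lj = 3) : 0 < n := by
  obtain ⟨o, -, P, -, hP, -⟩ := Set.nonempty_of_ncard_ne_zero
    (show {o | IsOLine n X o ∧ ∃ P ∈ o, IsKmNode n X 1 P ∧ (P ∈ li ∨ P ∈ lj)}.ncard ≠ 0 by
      unfold oLineCount at hnij; omega)
  by_contra hn
  obtain rfl : n = 0 := by omega
  obtain ⟨Q, hQ⟩ := Set.ncard_eq_one.1 (show X.ncard = 1 from hX.1.2.1)
  obtain ⟨R, hR, hRi, hRj⟩ := hX.exists_mem_inter hi hj
  have hPX := hP.1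
  rw [hQ, Set.mem_singleton_iff] at hR hPX
  subst hR hPX
  exact hij (hP.eq_of_mem hi hj hRi hRj)

end GCPlane

theorem proposition4p3 (n : ℕ) (X : Set Pt) (hX : IsGC n X) (hdef : defect n X = 2)
    (li lj : Set Pt) (hi : li ∈ maxLines n X) (hj : lj ∈ maxLines n X) (hij : li ≠ lj)
    (hnij : oLineCount n X li lj = 3) :
    -- the lines `o = ℓ^o_{k(i,j)}` and `l = ℓ_ij` are well defined
    (∃! ol : Set Pt × Set Pt, IsLinePair n X li lj ol.1 ol.2) ∧
    ∀ o l : Set Pt, IsLinePair n X li lj o l →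
      -- `o` and `l` have at most one common point `S`, the only candidate for a hat-`2_m`-node
      (o ∩ l).Subsingleton ∧
      (∀ A, IsHatTwoNode n X l A → A ∈ o ∩ l) ∧
      -- the lowering is a `GC_m` set of defect 1, and `o ∈ Pr(X) ∩ M(lowering)`
      ∃ m : ℕ, IsGC m (lowering n X l) ∧ defect m (lowering n X l) = 1 ∧
        IsProper n X o ∧ o ∈ maxLines m (lowering n X l) ∧
        (∀ S ∈ o ∩ l,
          [S ∈ lowering n X l,
            IsKmNode n X 1 S,
            IsHatTwoNode n X l S,
            ∃ c ∈ maxLines n X, c ∈ maxLines m (lowering n X l) ∧ o ∩ c = {S}].TFAE) ∧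
        (usingNodes n X l).ncard = 1 ∧
        IsProperMinus 1 n X l ∧
        (∀ C, HasDAItems n X l [C] → usingNodes n X l = lowering n X l \ (C ∪ l)) ∧
        -- `S` does not belong to the lowering (or does not exist, `o` and `l` being parallel)
        ((∀ S ∈ o ∩ l, S ∉ lowering n X l) →
          m = 2 ∧ ∀ C, HasDAItems n X l [C] → C = o) ∧
        -- `S` belongs to the lowering
        (∀ S ∈ o ∩ l, S ∈ lowering n X l →
          m = 3 ∧ ∀ C, HasDAItems n X l [C] → ∃ c ∈ maxLines n X, S ∈ c ∧ C = o ∪ c) := by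
  have two := IsDefectTwo.of_defect hX (pos_of_oLineCount hX hi hj hij hnij) hdef
  obtain ⟨o', l', O, A, a, a', b, b', c⟩ := two.exists_pairConfig hi hj hij hnij
  refine ⟨⟨(o', l'), c.isLinePair, fun ol h => Prod.ext_iff.2 (c.eq_of_isLinePair h)⟩, ?_⟩
  intro o l h
  obtain ⟨rfl, rfl⟩ := c.eq_of_isLinePair h
  -- The degree of the lowering is the number of kept maximal lines.
  refine ⟨c.inter_subsingleton, fun _ => c.mem_of_isHatTwoNode, (oneLines n X l).ncard,
    c.gc_lowering, c.defect_lowering, c.isProper_o, c.o_mem_maxLines, fun _ => c.one_tfae,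
    by rw [c.usingNodes_eq, Set.ncard_singleton], c.isProperMinus_one,
    fun C hC => by rw [c.usingNodes_eq, c.lowering_diff_eq hC], fun hS => ?_,
    fun S hS hSX => ?_⟩
  · replace hS : ∀ S ∈ o ∩ l, ¬ IsKmNode n X 1 S := fun S hSol h1 =>
      hS S hSol ((c.mem_lowering_iff hSol.2).2 h1)
    refine ⟨c.ncard_oneLines_pair hS, fun C hC => ?_⟩
    rcases c.item_cases hC with ⟨hCo, -⟩ | ⟨k, -, S, hSol, hS1, -⟩
    exacts [hCo, absurd hS1 (hS S hSol)]
  · have hS1 := (c.mem_lowering_iff hS.2).1 hSX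
    refine ⟨c.ncard_oneLines_triple hS hS1, fun C hC => ?_⟩
    rcases c.item_cases hC with ⟨-, hn⟩ | ⟨k, hk, T, hT, hT1, hTk, hCk⟩
    · exact absurd hS1 (hn S hS)
    · exact ⟨k, hk, c.inter_subsingleton hT hS ▸ hTk, hCk⟩
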